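/- Let $k$ be a field. All dg categories are small and $k$-linear, differentials have degree $+1$, and $\mathrm{Fun}_{dg}(A,B)$ denotes the set of dg functors $A\to B$. For homogeneous $g_1,\dots,g_n$ put $\sigma_j=\sum_{i>j}(|g_i|-1)$, so that $\sigma_0=\sum_{i}(|g_i|-1)$. *Twisted tensor product.* For dg categories $C,D$ let $C\tilde\otimes D$ be the dg category with objects $\mathrm{Ob}\,C\times\mathrm{Ob}\,D$ whose underlying graded $k$-linear category is generated by the morphisms $f\otimes \mathrm{id}_d:(c,d)\to(c',d)$ ($f:c\to c'$ in $C$), $\mathrm{id}_c\otimes g:(c,d)\to(c,d')$ ($g:d\to d'$ in $D$), of degrees $|f|$, $|g|$, and, for $n\ge1$, homogeneous $f:c\to c'$ in $C$ and composable homogeneous $d_0\xrightarrow{g_1}d_1\to\cdots\xrightarrow{g_n}d_n$ in $D$, by morphisms $\varepsilon(f;g_1,\dots,g_n):(c,d_0)\to(c',d_n)$ of degree $|f|+\sum_i(|g_i|-1)$, subject to the following relations, where $\varepsilon(f;)$ stands for $f\otimes\mathrm{id}_d$: 1. $f\mapsto f\otimes\mathrm{id}_d$ and $g\mapsto\mathrm{id}_c\otimes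 g$ are $k$-linear functors (in particular $\mathrm{id}_c\otimes\mathrm{id}_d$, in either family, is the identity of $(c,d)$); 2. $\varepsilon(f;g_1,\dots,g_n)$ is $k$-linear in each argument; 3. for $n\ge1$, $\varepsilon(f;g_1,\dots,g_n)=0$ if $f$ or some $g_i$ is an identity morphism; 4. $\varepsilon(f_2f_1;g_1,\dots,g_n)=\sum_{0\le m\le n}(-1)^{|f_1|\sigma_m}\,\varepsilon(f_2;g_{m+1},\dots,g_n)\,\varepsilon(f_1;g_1,\dots,g_m)$. The differential is the derivation with $d(f\otimes\mathrm{id})=df\otimes\mathrm{id}$, $d(\mathrm{id}\otimes g)=\mathrm{id}\otimes dg$ and, for $n\ge1$, $$\begin{aligned}d\,\varepsilon(f;g_1,\dots,g_n)={}&\varepsilon(df;g_1,\dots,g_n)-(-1)^{|f|}\sum_{j=1}^n(-1)^{\sigma_j}\varepsilon(f;g_1,\dots,dg_j,\dots,g_n)\\&+(-1)^{|f|}\sum_{j=1}^{n-1}(-1)^{\sigma_{j+1}+|g_{j+1}|}\varepsilon(f;g_1,\dots,g_{j+1}g_j,\dots,g_n)\\&-(-1)^{|f|(|g_n|-1)}(\mathrm{id}_{c'}\otimes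 g_n)\,\varepsilon(f;g_1,\dots,g_{n-1})+(-1)^{|f|+\sigma_1}\varepsilon(f;g_2,\dots,g_n)\,(\mathrm{id}_c\otimes g_1).\end{aligned}$$ *Coherent natural transformations.* For dg categories $D,E$ let $\mathcal{C}oh_{dg}(D,E)$ be the dg category whose objects are the dg functors $D\to E$ and whose morphisms $F\Rightarrow G$ of degree $p$ are the normalised Hochschild cochains of total degree $p$ of $D$ with values in $\mathrm{Hom}_E(F-,G-)$: families $\Psi$ of morphisms $\Psi(g_1,\dots,g_n):F(d_0)\to G(d_n)$ of degree $p+\sum_i(|g_i|-1)$, for all $n\ge0$ and all composable homogeneous $g_1,\dots,g_n$ in $D$ (for $n=0$: a morphism $F(d)\to G(d)$ for each object $d$), $k$-linear in each $g_i$ and zero if some $g_i$ is an identity. The composition is $$(\Psi_2\Psi_1)(g_1,\dots,g_n)=\sum_{0\le m\le n}(-1)^{|\Psi_1|\sigma_m}\Psi_2(g_{m+1},\dots,g_n)\circ\Psi_1(g_1,\dots,g_m),$$ the identity of $F$ is $\mathrm{id}_{F(d)}$ for $n=0$ and zero for $n\ge1$, and the differential is $$\begin{aligned}(d\Psi)(g_1,\dots,g_n)={}&d_E\big(\Psi(g_1,\dots,g_n)\big)+(-1)^{p(|g_n|-1)}G(g_n)\circ\Psi(g_1,\dots,g_{n-1})-(-1)^{p+\sigma_1}\Psi(g_2,\dots,g_n)\circ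 F(g_1)\\&+(-1)^p\sum_{j=1}^n(-1)^{\sigma_j}\Psi(g_1,\dots,dg_j,\dots,g_n)-(-1)^p\sum_{j=1}^{n-1}(-1)^{\sigma_{j+1}+|g_{j+1}|}\Psi(g_1,\dots,g_{j+1}g_j,\dots,g_n),\end{aligned}$$ where for $n=0$ only the first term is present. **Theorem.** There are bijections $$\Phi_{C,D,E}:\ \mathrm{Fun}_{dg}(C\tilde\otimes D,E)\ \cong\ \mathrm{Fun}_{dg}(C,\mathcal{C}oh_{dg}(D,E)),$$ for all small dg categories $C,D,E$ over $k$, which are natural in $C$, $D$ and $E$: for dg functors $a:C'\to C$, $b:D'\to D$, $h:E\to E'$ and $F:C\tilde\otimes D\to E$, $$\Phi_{C',D',E'}\big(h\circ F\circ(a\tilde\otimes b)\big)=\mathcal{C}oh_{dg}(b,h)\circ\Phi_{C,D,E}(F)\circ a,$$ where $a\tilde\otimes b$ is the dg functor $C'\tilde\otimes D'\to C\tilde\otimes D$, $\varepsilon(f;g_1,\dots,g_n)\mapsto\varepsilon(a f;b g_1,\dots,b g_n)$, $\mathrm{id}\otimes g\mapsto\mathrm{id}\otimes bg$ (with $n=0$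 included), and $\mathcal{C}oh_{dg}(b,h)$ is the dg functor sending $G$ to $h\circ G\circ b$ and $\Psi$ to $(g_1,\dots,g_n)\mapsto h(\Psi(b g_1,\dots,b g_n))$. (These are bijections of sets of dg functors, in the category of small dg categories itself and not in its homotopy category.) -/

import Mathlib

universe u

namespace DG

/-- The sign `(-1) ^ m` in the ground ring, for an integer `m`. -/
def sgn (k : Type u) [CommRing k] (m : ℤ) : k := (((-1 : kˣ) ^ m : kˣ) : k)

section Sign

variable {k : Type u} [CommRing k]

@[simp] theorem sgn_zero : sgn k 0 = 1 := by simp [sgn]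

@[simp] theorem sgn_one : sgn k 1 = -1 := by simp [sgn]

theorem sgn_add (m n : ℤ) : sgn k (m + n) = sgn k m * sgn k n := by simp [sgn, zpow_add]

theorem sgn_neg (m : ℤ) : sgn k (-m) = sgn k m := by
  have h : (-1 : kˣ)⁻¹ = -1 := by rw [inv_eq_iff_mul_eq_one]; simp
  simp only [sgn, zpow_neg, ← inv_zpow, h]

theorem sgn_sub (m n : ℤ) : sgn k (m - n) = sgn k m * sgn k n := by
  rw [sub_eq_add_neg, sgn_add, sgn_neg]

theorem sgn_cases (m : ℤ) : sgn k m = 1 ∨ sgn k m = -1 := by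
  rcases Int.even_or_odd m with h | h
  · left; simp [sgn, h.neg_one_zpow]
  · right; simp [sgn, h.neg_one_zpow]

theorem sgn_mul_self (m : ℤ) : sgn k m * sgn k m = 1 := by
  rcases sgn_cases (k := k) m with h | h <;> simp [h]

end Sign

/-- A small `ℤ`-graded `k`-linear category. The composition of homogeneous morphisms `f` of degree
`m` and `g` of degree `n` is `comp h f g` (that is, `f ∘ g`), where `h : m + n = p` records the
degree `p` of the result. -/
structure GrCat (k : Type u) [CommRing k] where
  Obj : Type u
  Hom : Obj → Obj → ℤ → Type u
  [addCommGroup : ∀ X Y n, AddCommGroup (Hom X Y n)]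
  [module : ∀ X Y n, Module k (Hom X Y n)]
  id : ∀ X, Hom X X 0
  comp : ∀ {X Y Z : Obj} {m n p : ℤ}, m + n = p → Hom Y Z m →ₗ[k] Hom X Y n →ₗ[k] Hom X Z p
  id_comp : ∀ {X Y : Obj} {n : ℤ} (f : Hom X Y n), comp (zero_add n) (id Y) f = f
  comp_id : ∀ {X Y : Obj} {n : ℤ} (f : Hom X Y n), comp (add_zero n) f (id X) = f
  assoc : ∀ {X Y Z W : Obj} {a b c ab bc abc : ℤ} (h₁ : a + b = ab) (h₂ : ab + c = abc)
    (h₃ : b + c = bc) (h₄ : a + bc = abc) (f : Hom Z W a) (g : Hom Y Z b) (h : Hom X Y c),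
    comp h₂ (comp h₁ f g) h = comp h₄ f (comp h₃ g h)

attribute [instance] GrCat.addCommGroup GrCat.module

variable {k : Type u} [CommRing k]

/-- Transport of a morphism along an equality of degrees. -/
def GrCat.cast (C : GrCat k) {X Y : C.Obj} {m n : ℤ} (h : m = n) (f : C.Hom X Y m) :
    C.Hom X Y n := h ▸ f

@[simp] theorem GrCat.cast_rfl (C : GrCat k) {X Y : C.Obj} {m : ℤ} (f : C.Hom X Y m) :
    C.cast rfl f = f := rfl

theorem GrCat.cast_add (C : GrCat k) {X Y : C.Obj} {m n : ℤ} (h : m = n) (f g : C.Hom X Y m) :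
    C.cast h (f + g) = C.cast h f + C.cast h g := by subst h; rfl

theorem GrCat.cast_smul (C : GrCat k) {X Y : C.Obj} {m n : ℤ} (h : m = n) (x : k)
    (f : C.Hom X Y m) : C.cast h (x • f) = x • C.cast h f := by subst h; rfl

theorem GrCat.cast_neg (C : GrCat k) {X Y : C.Obj} {m n : ℤ} (h : m = n)
    (f : C.Hom X Y m) : C.cast h (-f) = -C.cast h f := by subst h; rfl

theorem GrCat.cast_cast (C : GrCat k) {X Y : C.Obj} {m n p : ℤ} (h : m = n) (h' : n = p)
    (f : C.Hom X Y m) : C.cast h' (C.cast h f) = C.cast (h.trans h') f := by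
  subst h h'; rfl

theorem GrCat.comp_cast (C : GrCat k) {X Y Z : C.Obj} {m n p m' n' p' : ℤ} (hm : m = m')
    (hn : n = n') (h : m' + n' = p) (h' : m + n = p') (f : C.Hom Y Z m) (g : C.Hom X Y n) :
    C.comp h (C.cast hm f) (C.cast hn g) = C.cast (by omega) (C.comp h' f g) := by
  subst hm hn h h'; rfl

theorem GrCat.cast_comp (C : GrCat k) {X Y Z : C.Obj} {m n p m' : ℤ} (hm : m = m')
    (h : m' + n = p) (f : C.Hom Y Z m) (g : C.Hom X Y n) :
    C.comp h (C.cast hm f) g = C.comp (by omega) f g := by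
  subst hm; rfl

theorem GrCat.cast_id_comp (C : GrCat k) {X Y : C.Obj} {z m p : ℤ} (hz : 0 = z) (h : z + m = p)
    (f : C.Hom X Y m) : C.comp h (C.cast hz (C.id Y)) f = C.cast (by omega) f := by
  subst hz; obtain rfl : m = p := by omega
  exact C.id_comp f

theorem GrCat.comp_cast_id (C : GrCat k) {X Y : C.Obj} {z m p : ℤ} (hz : 0 = z) (h : m + z = p)
    (f : C.Hom X Y m) : C.comp h f (C.cast hz (C.id X)) = C.cast (by omega) f := by
  subst hz; obtain rfl : m = p := by omega
  exact C.comp_id f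

/-- A small dg category over `k` (cohomological grading, differential of degree `+1`). -/
structure DGCat (k : Type u) [CommRing k] extends GrCat k where
  d : ∀ {X Y : Obj} {m n : ℤ}, m + 1 = n → Hom X Y m →ₗ[k] Hom X Y n
  d_d : ∀ {X Y : Obj} {l m n : ℤ} (h₁ : l + 1 = m) (h₂ : m + 1 = n) (f : Hom X Y l),
    d h₂ (d h₁ f) = 0
  leibniz : ∀ {X Y Z : Obj} {m n p m' n' p' : ℤ} (h : m + n = p) (hm : m + 1 = m')
    (hn : n + 1 = n') (hp : p + 1 = p') (f : Hom Y Z m) (g : Hom X Y n),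
    d hp (comp h f g) =
      comp (by omega) (d hm f) g + sgn k m • comp (by omega) f (d hn g)

/-- A `k`-linear functor of degree `0` between graded categories. -/
structure GrFunctor (C D : GrCat k) where
  obj : C.Obj → D.Obj
  map : ∀ {X Y : C.Obj} {n : ℤ}, C.Hom X Y n →ₗ[k] D.Hom (obj X) (obj Y) n
  map_id : ∀ X, map (C.id X) = D.id (obj X)
  map_comp : ∀ {X Y Z : C.Obj} {m n p : ℤ} (h : m + n = p) (f : C.Hom Y Z m) (g : C.Hom X Y n),
    map (C.comp h f g) = D.comp h (map f) (map g)

/-- A dg functor: a graded functor that commutes with the differentials. -/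
structure DGFunctor (C D : DGCat k) extends GrFunctor C.toGrCat D.toGrCat where
  map_d : ∀ {X Y : C.Obj} {m n : ℤ} (h : m + 1 = n) (f : C.Hom X Y m),
    map (C.d h f) = D.d h (map f)

/-- Composition of graded functors (first `F`, then `G`). -/
def GrFunctor.comp {C D E : GrCat k} (F : GrFunctor C D) (G : GrFunctor D E) : GrFunctor C E where
  obj X := G.obj (F.obj X)
  map := G.map ∘ₗ F.map
  map_id X := by simp [F.map_id, G.map_id]
  map_comp h f g := by simp [F.map_comp, G.map_comp]

/-- Composition of dg functors (first `F`, then `G`). -/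
def DGFunctor.comp {C D E : DGCat k} (F : DGFunctor C D) (G : DGFunctor D E) :
    DGFunctor C E where
  toGrFunctor := F.toGrFunctor.comp G.toGrFunctor
  map_d h f := by
    change G.map (F.map _) = E.d h (G.map (F.map f))
    rw [F.map_d, G.map_d]

theorem GrFunctor.map_cast {C D : GrCat k} (F : GrFunctor C D) {X Y : C.Obj} {m n : ℤ}
    (h : m = n) (f : C.Hom X Y m) : F.map (C.cast h f) = D.cast h (F.map f) := by
  subst h; rfl

theorem DGCat.d_id_cast (C : DGCat k) {X : C.Obj} {m n : ℤ} (hm : 0 = m) (h : m + 1 = n) :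
    C.d h (C.cast hm (C.id X)) = 0 := by
  subst hm
  obtain rfl : n = 1 := by omega
  have := C.leibniz (add_zero 0) h h h (C.id X) (C.id X)
  rw [C.id_comp, C.comp_id, C.id_comp] at this
  simpa using this

/-! ### Chains of composable homogeneous morphisms -/

/-- `Chain D y₀ y t` is the type of chains `y₀ → y₁ → ⋯ → yₙ = y` of composable homogeneous
morphisms `g₁, …, gₙ` of `D`, of arbitrary length `n ≥ 0`, with
`t = (|g₁| - 1) + ⋯ + (|gₙ| - 1)`. The chain `snoc c g h` is `c` followed by `g`. -/
inductive Chain (D : GrCat k) : D.Obj → D.Obj → ℤ → Type u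
  | nil (y : D.Obj) : Chain D y y 0
  | snoc {y₀ y y' : D.Obj} {s a t : ℤ} (c : Chain D y₀ y s) (g : D.Hom y y' a)
      (h : s + (a - 1) = t) : Chain D y₀ y' t

namespace Chain

variable {D : GrCat k}

/-- `LinComb r c c₁ c₂` : the three chains agree except in one slot, where the morphism of `c` is
`r • g₁ + g₂` with `g₁`, `g₂` the morphisms of `c₁`, `c₂` in that slot. -/
inductive LinComb (r : k) : ∀ {y₀ y : D.Obj} {t : ℤ},
    Chain D y₀ y t → Chain D y₀ y t → Chain D y₀ y t → Prop
  | here {y₀ y y' : D.Obj} {s a t : ℤ} (c : Chain D y₀ y s) (g₁ g₂ : D.Hom y y' a)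
      (h : s + (a - 1) = t) : LinComb r (c.snoc (r • g₁ + g₂) h) (c.snoc g₁ h) (c.snoc g₂ h)
  | snoc {y₀ y y' : D.Obj} {s a t : ℤ} {c c₁ c₂ : Chain D y₀ y s} (g : D.Hom y y' a)
      (h : s + (a - 1) = t) (hc : LinComb r c c₁ c₂) :
      LinComb r (c.snoc g h) (c₁.snoc g h) (c₂.snoc g h)

/-- One of the morphisms of the chain is an identity. -/
inductive HasId : ∀ {y₀ y : D.Obj} {t : ℤ}, Chain D y₀ y t → Prop
  | here {y₀ y : D.Obj} {s t : ℤ} (c : Chain D y₀ y s) (h : s + (0 - 1) = t) :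
      HasId (c.snoc (D.id y) h)
  | snoc {y₀ y y' : D.Obj} {s a t : ℤ} {c : Chain D y₀ y s} (g : D.Hom y y' a)
      (h : s + (a - 1) = t) (hc : HasId c) : HasId (c.snoc g h)

/-- The chain has at least one morphism. -/
inductive Pos : ∀ {y₀ y : D.Obj} {t : ℤ}, Chain D y₀ y t → Prop
  | snoc {y₀ y y' : D.Obj} {s a t : ℤ} (c : Chain D y₀ y s) (g : D.Hom y y' a)
      (h : s + (a - 1) = t) : Pos (c.snoc g h)

/-- The sum `∑_{0 ≤ m ≤ n} Φ (g₁, …, g_m) (g_{m+1}, …, gₙ)` over all ways to cut a chain in two. -/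
def splitSum {M : Type u} [Add M] : ∀ {y₀ y₁ : D.Obj} {t : ℤ}, Chain D y₀ y₁ t →
    (∀ (y : D.Obj) (s r : ℤ), s + r = t → Chain D y₀ y s → Chain D y y₁ r → M) → M
  | _, _, _, nil _, Φ => Φ _ 0 0 (add_zero 0) (nil _) (nil _)
  | _, _, _, snoc c g h, Φ =>
      Φ _ _ 0 (add_zero _) (snoc c g h) (nil _) +
        c.splitSum fun y s r hsr c₁ c₂ => Φ y s _ (by omega) c₁ (snoc c₂ g rfl)

/-- For `c = (g₁, …, gₙ)`, the term `(-1) ^ |g| • Φ (g₁, …, g_{n-1}, g ∘ gₙ)`; it is `0` if the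
chain `c` is empty. -/
def lastComp {M : Type u} [AddCommGroup M] [Module k M] : ∀ {y₀ y y' : D.Obj} {s a t : ℤ},
    Chain D y₀ y s → D.Hom y y' a → s + a = t → (Chain D y₀ y' t → M) → M
  | _, _, _, _, _, _, nil _, _, _, _ => 0
  | _, _, _, _, a, _, snoc c g' _, g, _, Φ => sgn k a • Φ (snoc c (D.comp rfl g g') (by omega))

end Chain

/-- The value of `Φ` on the bar differential of the chain `c = (g₁, …, gₙ)`:
`∑_j (-1) ^ (∑_{i > j} (|g_i| - 1)) • (-Φ (g₁, …, d g_j, …, gₙ))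
  + ∑_{j < n} (-1) ^ (∑_{i > j + 1} (|g_i| - 1) + |g_{j+1}|) • Φ (g₁, …, g_{j+1} ∘ g_j, …, gₙ)`. -/
def Chain.barSum {D : DGCat k} {M : Type u} [AddCommGroup M] [Module k M] :
    ∀ {y₀ y : D.Obj} {t t' : ℤ}, Chain D.toGrCat y₀ y t → t + 1 = t' →
      (Chain D.toGrCat y₀ y t' → M) → M
  | _, _, _, _, nil _, _, _ => 0
  | _, _, _, _, @snoc _ _ _ _ _ _ _ a _ c g h, h', Φ =>
      -Φ (snoc c (D.d rfl g) (by omega)) + lastComp c g (by omega) Φ +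
        sgn k (a - 1) • barSum c rfl fun c' => Φ (snoc c' g (by omega))

/-- `Φ` is `k`-linear in each morphism of the chain. -/
def MultiLin {D : GrCat k} {M : Type u} [AddCommGroup M] [Module k M] {y₀ y : D.Obj} {t : ℤ}
    (Φ : Chain D y₀ y t → M) : Prop :=
  ∀ (r : k) (c c₁ c₂ : Chain D y₀ y t), Chain.LinComb r c c₁ c₂ → Φ c = r • Φ c₁ + Φ c₂

namespace Chain

section SumLemmas

variable {D : GrCat k} {M N : Type u} [AddCommGroup M] [Module k M] [AddCommGroup N] [Module k N]

theorem apply_snoc {M : Type u} {y₀ y₁ y₂ : D.Obj} {r b q q' : ℤ} {P : ℤ → Prop}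
    (Φ : ∀ q : ℤ, P q → Chain D y₀ y₂ q → M) (c : Chain D y₀ y₁ r) (g : D.Hom y₁ y₂ b)
    (hq : r + (b - 1) = q) (hq' : r + (b - 1) = q') (p : P q) (p' : P q') :
    Φ q p (snoc c g hq) = Φ q' p' (snoc c g hq') := by
  subst hq hq'; rfl

theorem splitSum_map {M N : Type u} [Add M] [Add N] (f : M → N) (hf : ∀ x y, f (x + y) = f x + f y)
    {y₀ y₁ : D.Obj} {t : ℤ} (c : Chain D y₀ y₁ t)
    (Φ : ∀ (y : D.Obj) (s r : ℤ), s + r = t → Chain D y₀ y s → Chain D y y₁ r → M) :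
    f (c.splitSum Φ) = c.splitSum fun y s r h c₁ c₂ => f (Φ y s r h c₁ c₂) := by
  induction c with
  | nil => simp only [splitSum]
  | snoc c g h ih => simp only [splitSum, hf, ih]

theorem splitSum_add {y₀ y₁ : D.Obj} {t : ℤ} (c : Chain D y₀ y₁ t)
    (Φ Φ' : ∀ (y : D.Obj) (s r : ℤ), s + r = t → Chain D y₀ y s → Chain D y y₁ r → M) :
    (c.splitSum fun y s r h c₁ c₂ => Φ y s r h c₁ c₂ + Φ' y s r h c₁ c₂) =
      c.splitSum Φ + c.splitSum Φ' := by
  induction c with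
  | nil => simp only [splitSum]
  | snoc c g h ih => simp only [splitSum, ih]; abel

theorem splitSum_smul {y₀ y₁ : D.Obj} {t : ℤ} (x : k) (c : Chain D y₀ y₁ t)
    (Φ : ∀ (y : D.Obj) (s r : ℤ), s + r = t → Chain D y₀ y s → Chain D y y₁ r → M) :
    (c.splitSum fun y s r h c₁ c₂ => x • Φ y s r h c₁ c₂) = x • c.splitSum Φ :=
  (splitSum_map (fun m => x • m) (smul_add x) c Φ).symm

theorem splitSum_neg {y₀ y₁ : D.Obj} {t : ℤ} (c : Chain D y₀ y₁ t)
    (Φ : ∀ (y : D.Obj) (s r : ℤ), s + r = t → Chain D y₀ y s → Chain D y y₁ r → M) :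
    (c.splitSum fun y s r h c₁ c₂ => -Φ y s r h c₁ c₂) = -c.splitSum Φ :=
  (splitSum_map (fun m => -m) neg_add c Φ).symm

theorem splitSum_zero {y₀ y₁ : D.Obj} {t : ℤ} (c : Chain D y₀ y₁ t) :
    (c.splitSum fun _ _ _ _ _ _ => (0 : M)) = 0 := by
  induction c with
  | nil => simp only [splitSum, add_zero]
  | snoc c g h ih => simp only [splitSum, ih, add_zero]

/-- Coassociativity of the cutting of chains. -/
theorem splitSum_assoc {y₀ y₁ : D.Obj} {t : ℤ} (c : Chain D y₀ y₁ t)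
    (Φ : ∀ (y : D.Obj) (y' : D.Obj) (s r q : ℤ), s + r + q = t →
      Chain D y₀ y s → Chain D y y' r → Chain D y' y₁ q → M) :
    (c.splitSum fun y' _ q h c₁₂ c₃ => c₁₂.splitSum fun y s r h' c₁ c₂ =>
        Φ y y' s r q (by omega) c₁ c₂ c₃) =
      c.splitSum fun y s _ h c₁ c₂₃ => c₂₃.splitSum fun y' r q h' c₂ c₃ =>
        Φ y y' s r q (by omega) c₁ c₂ c₃ := by
  induction c with
  | nil => simp only [splitSum]
  | snoc c g h ih =>
    simp only [splitSum, splitSum_add, add_assoc]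
    congr 2
    exact ih fun y y' s r q h c₁ c₂ c₃ => Φ y y' s r _ (by omega) c₁ c₂ (snoc c₃ g rfl)

theorem splitSum_multiLin {y₀ y₁ : D.Obj} {t : ℤ}
    (Φ : ∀ (y : D.Obj) (s r : ℤ), s + r = t → Chain D y₀ y s → Chain D y y₁ r → M)
    (h₁ : ∀ y s r h c₂, MultiLin fun c₁ => Φ y s r h c₁ c₂)
    (h₂ : ∀ y s r h c₁, MultiLin fun c₂ => Φ y s r h c₁ c₂) :
    MultiLin fun c : Chain D y₀ y₁ t => c.splitSum Φ := by
  intro r c c₁ c₂ hc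
  induction hc with
  | @here _ _ s₀ a _ c g₁ g₂ h =>
    simp only [splitSum]
    have e := h₁ _ _ _ (add_zero _) (nil _) r _ _ _ (LinComb.here c g₁ g₂ h)
    simp only at e
    rw [e]
    have : ∀ y s q (hq : s + (q + (a - 1)) = _) (c₁ : Chain D y₀ y s) (c₂ : Chain D y _ q),
        Φ y s (q + (a - 1)) hq c₁ (snoc c₂ (r • g₁ + g₂) rfl) =
          r • Φ y s _ hq c₁ (snoc c₂ g₁ rfl) +
            Φ y s _ hq c₁ (snoc c₂ g₂ rfl) :=
      fun y s q hq c₁ c₂ => h₂ _ _ _ _ _ r _ _ _ (LinComb.here c₂ g₁ g₂ rfl)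
    simp only [this, splitSum_add, splitSum_smul, smul_add]
    abel
  | snoc g h hc ih =>
    simp only [splitSum]
    have e := h₁ _ _ _ (add_zero _) (nil _) r _ _ _ (LinComb.snoc g h hc)
    have e' := ih (fun y s q hq c₁ c₂ => Φ y s _ (by omega) c₁ (snoc c₂ g rfl))
      (fun y s q hq c₂ => h₁ _ _ _ _ _)
      (fun y s q hq c₁ r c c' c'' hc => h₂ _ _ _ _ _ r _ _ _ (LinComb.snoc g rfl hc))
    simp only at e e'
    rw [e, e', smul_add]
    abel

theorem splitSum_hasId {y₀ y₁ : D.Obj} {t : ℤ} {c : Chain D y₀ y₁ t} (hc : HasId c)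
    (Φ : ∀ (y : D.Obj) (s r : ℤ), s + r = t → Chain D y₀ y s → Chain D y y₁ r → M)
    (h₁ : ∀ y s r h c₁ c₂, HasId c₁ → Φ y s r h c₁ c₂ = 0)
    (h₂ : ∀ y s r h c₁ c₂, HasId c₂ → Φ y s r h c₁ c₂ = 0) : c.splitSum Φ = 0 := by
  induction hc with
  | here c h =>
    simp only [splitSum]
    rw [h₁ _ _ _ _ _ _ (HasId.here c h)]
    simp only [h₂ _ _ _ _ _ _ (HasId.here _ rfl), splitSum_zero, add_zero]
  | snoc g h hc ih =>
    simp only [splitSum]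
    rw [h₁ _ _ _ _ _ _ (HasId.snoc g h hc)]
    rw [ih (fun y s q hq c₁ c₂ => Φ y s _ (by omega) c₁ (snoc c₂ g rfl))
      (fun y s q hq c₁ c₂ hc => h₁ _ _ _ _ _ _ hc)
      (fun y s q hq c₁ c₂ hc => h₂ _ _ _ _ _ _ (HasId.snoc g rfl hc)), add_zero]

theorem lastComp_nil {y y' : D.Obj} {a t : ℤ} (g : D.Hom y y' a) (h : 0 + a = t)
    (Φ : Chain D y y' t → M) : (nil y : Chain D y y 0).lastComp g h Φ = 0 := by
  rw [lastComp]

theorem lastComp_snoc {y₀ y₁ y y' : D.Obj} {s' b s a t : ℤ} (c : Chain D y₀ y₁ s')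
    (g' : D.Hom y₁ y b) (h' : s' + (b - 1) = s) (g : D.Hom y y' a) (h : s + a = t)
    (Φ : Chain D y₀ y' t → M) :
    (snoc c g' h').lastComp g h Φ = sgn k a • Φ (snoc c (D.comp rfl g g') (by omega)) := by
  rw [lastComp]

theorem lastComp_congr {y₀ y₁ y₂ : D.Obj} {r b q q' : ℤ} {P : ℤ → Prop}
    (Φ : ∀ q : ℤ, P q → Chain D y₀ y₂ q → M) (c : Chain D y₀ y₁ r) (g : D.Hom y₁ y₂ b)
    (hq : r + b = q) (hq' : r + b = q') (p : P q) (p' : P q') :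
    (c.lastComp g hq fun c => Φ q p c) = c.lastComp g hq' fun c => Φ q' p' c := by
  subst hq hq'; rfl

theorem lastComp_map (f : M →ₗ[k] N) {y₀ y y' : D.Obj} {s a t : ℤ} (c : Chain D y₀ y s)
    (g : D.Hom y y' a) (h : s + a = t) (Φ : Chain D y₀ y' t → M) :
    f (lastComp c g h Φ) = lastComp c g h fun c => f (Φ c) := by
  cases c <;> simp [lastComp]

theorem lastComp_add {y₀ y y' : D.Obj} {s a t : ℤ} (c : Chain D y₀ y s)
    (g : D.Hom y y' a) (h : s + a = t) (Φ Φ' : Chain D y₀ y' t → M) :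
    (lastComp c g h fun c => Φ c + Φ' c) = lastComp c g h Φ + lastComp c g h Φ' := by
  cases c <;> simp [lastComp]

theorem lastComp_smul {y₀ y y' : D.Obj} {s a t : ℤ} (x : k) (c : Chain D y₀ y s)
    (g : D.Hom y y' a) (h : s + a = t) (Φ : Chain D y₀ y' t → M) :
    (lastComp c g h fun c => x • Φ c) = x • lastComp c g h Φ := by
  cases c <;> simp [lastComp, smul_comm x]

theorem lastComp_lin {y₀ y y' : D.Obj} {s a t : ℤ} (r : k) (c : Chain D y₀ y s)
    (g₁ g₂ : D.Hom y y' a) (h : s + a = t) (Φ : Chain D y₀ y' t → M) (hΦ : MultiLin Φ) :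
    lastComp c (r • g₁ + g₂) h Φ = r • lastComp c g₁ h Φ + lastComp c g₂ h Φ := by
  cases c with
  | nil => simp [lastComp]
  | snoc c g' h' =>
    simp only [lastComp, map_add, map_smul, LinearMap.add_apply, LinearMap.smul_apply]
    rw [hΦ r _ _ _ (LinComb.here c _ _ _), smul_add, smul_comm]

theorem lastComp_multiLin {y₀ y y' : D.Obj} {s a t : ℤ} (g : D.Hom y y' a) (h : s + a = t)
    (Φ : Chain D y₀ y' t → M) (hΦ : MultiLin Φ) :
    MultiLin fun c : Chain D y₀ y s => lastComp c g h Φ := by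
  intro r c c₁ c₂ hc
  cases hc with
  | here c g₁ g₂ h' =>
    simp only [lastComp, map_add, map_smul]
    rw [hΦ r _ _ _ (LinComb.here c _ _ _), smul_add, smul_comm]
  | snoc g' h' hc =>
    simp only [lastComp]
    rw [hΦ r _ _ _ (LinComb.snoc _ _ hc), smul_add, smul_comm]

end SumLemmas

theorem MultiLin.zero_last {D : GrCat k} {M : Type u} [AddCommGroup M] [Module k M]
    {y₀ y y' : D.Obj} {s a t : ℤ} (c : Chain D y₀ y s) (h : s + (a - 1) = t)
    (Φ : Chain D y₀ y' t → M) (hΦ : MultiLin Φ) : Φ (snoc c 0 h) = 0 := by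
  have := hΦ 1 _ _ _ (LinComb.here c (0 : D.Hom y y' a) 0 h)
  simpa using this

section BarLemmas

variable {D : DGCat k} {M N : Type u} [AddCommGroup M] [Module k M] [AddCommGroup N] [Module k N]

theorem barSum_map (f : M →ₗ[k] N) {y₀ y : D.Obj} {t t' : ℤ} (c : Chain D.toGrCat y₀ y t)
    (h : t + 1 = t') (Φ : Chain D.toGrCat y₀ y t' → M) :
    f (c.barSum h Φ) = c.barSum h fun c => f (Φ c) := by
  induction c generalizing t' with
  | nil => simp [barSum]
  | snoc c g h ih => simp only [barSum, map_add, map_neg, map_smul, ih, lastComp_map]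

theorem barSum_add {y₀ y : D.Obj} {t t' : ℤ} (c : Chain D.toGrCat y₀ y t)
    (h : t + 1 = t') (Φ Φ' : Chain D.toGrCat y₀ y t' → M) :
    (c.barSum h fun c => Φ c + Φ' c) = c.barSum h Φ + c.barSum h Φ' := by
  induction c generalizing t' with
  | nil => simp [barSum]
  | snoc c g h ih => simp only [barSum, ih, lastComp_add, smul_add]; abel

theorem barSum_smul {y₀ y : D.Obj} {t t' : ℤ} (x : k) (c : Chain D.toGrCat y₀ y t)
    (h : t + 1 = t') (Φ : Chain D.toGrCat y₀ y t' → M) :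
    (c.barSum h fun c => x • Φ c) = x • c.barSum h Φ :=
  (barSum_map (LinearMap.lsmul k M x) c h Φ).symm

theorem barSum_zero {y₀ y : D.Obj} {t t' : ℤ} (c : Chain D.toGrCat y₀ y t) (h : t + 1 = t') :
    (c.barSum h fun _ => (0 : M)) = 0 := by
  simpa using barSum_smul (0 : k) c h (fun _ => (0 : M))

theorem barSum_multiLin {y₀ y : D.Obj} {t t' : ℤ} (h : t + 1 = t')
    (Φ : Chain D.toGrCat y₀ y t' → M) (hΦ : MultiLin Φ) :
    MultiLin fun c : Chain D.toGrCat y₀ y t => c.barSum h Φ := by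
  intro r c c₁ c₂ hc
  induction hc generalizing t' with
  | @here _ _ s a _ c g₁ g₂ h' =>
    have : ∀ c' : Chain D.toGrCat _ _ (s + 1), Φ (snoc c' (r • g₁ + g₂) (by omega)) =
        r • Φ (snoc c' g₁ (by omega)) + Φ (snoc c' g₂ (by omega)) :=
      fun c' => hΦ r _ _ _ (LinComb.here c' g₁ g₂ (by omega))
    simp only [barSum, this, barSum_add, barSum_smul, map_add, map_smul,
      lastComp_lin _ _ _ _ _ _ hΦ]
    rw [hΦ r _ _ _ (LinComb.here c _ _ _)]
    module
  | @snoc _ _ s a _ _ _ _ g h' hc ih =>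
    simp only [barSum]
    have h₁ := lastComp_multiLin g (by omega) Φ hΦ r _ _ _ hc
    have h₂ := ih rfl (fun c' => Φ (snoc c' g (by omega))) (fun r c c' c'' hc => hΦ r _ _ _ (LinComb.snoc g (by omega) hc))
    simp only at h₁ h₂
    rw [hΦ r _ _ _ (LinComb.snoc _ _ hc), h₁, h₂]
    module

/-- The bar differential is a coderivation. -/
theorem barSum_splitSum {y₀ y₁ : D.Obj} {t t' : ℤ} (c : Chain D.toGrCat y₀ y₁ t) (ht : t + 1 = t')
    (Φ : ∀ (y : D.Obj) (s r : ℤ), s + r = t' →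
      Chain D.toGrCat y₀ y s → Chain D.toGrCat y y₁ r → M) :
    (c.barSum ht fun c' => c'.splitSum Φ) = c.splitSum fun y s r h c₁ c₂ =>
      (c₂.barSum rfl fun c₂' => Φ y s _ (by omega) c₁ c₂') +
        sgn k r • c₁.barSum rfl fun c₁' => Φ y _ r (by omega) c₁' c₂ := by
  induction c generalizing t' with
  | nil => simp [barSum, splitSum]
  | @snoc y₁ y₂ s a t c g h ih =>
    have key : c.lastComp g (t := t') (by omega) (fun c' => c'.splitSum Φ) =
        c.lastComp g (t := t') (by omega) (fun c' => Φ _ _ _ (by omega) c' (nil _)) +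
        c.splitSum fun y s r h c₁ c₂ => c₂.lastComp g rfl fun c₂' => Φ y s _ (by omega) c₁ c₂' := by
      cases c with
      | nil => simp [lastComp, splitSum]
      | snoc c g' h' =>
        simp only [lastComp, splitSum, splitSum_smul, smul_add, zero_add]
        congr 3
        funext y s r h c₁ c₂
        exact apply_snoc (P := fun q => s + q = t') (fun q p c => Φ y s q p c₁ c) _ _ _ _ _ _
    have e₁ : ∀ y s' r (p : s' + (r + (a - 1) + 1) = t') (c₁ : Chain D.toGrCat y₀ y s')
        (c₂ : Chain D.toGrCat y y₁ r),
        Φ y s' (r + (a - 1) + 1) p c₁ (snoc c₂ (D.d rfl g) (by omega)) =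
        Φ y s' (r + (a + 1 - 1)) (by omega) c₁ (snoc c₂ (D.d rfl g) rfl) := fun y s' r p c₁ c₂ =>
      apply_snoc (P := fun q => s' + q = t') (fun q p c => Φ y s' q p c₁ c) _ _ _ _ _ _
    have e₂ : ∀ y s' r (p : s' + (r + (a - 1) + 1) = t') (c₁ : Chain D.toGrCat y₀ y s')
        (c₂ : Chain D.toGrCat y y₁ (r + 1)),
        Φ y s' (r + (a - 1) + 1) p c₁ (snoc c₂ g (by omega)) =
        Φ y s' (r + 1 + (a - 1)) (by omega) c₁ (snoc c₂ g rfl) := fun y s' r p c₁ c₂ =>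
      apply_snoc (P := fun q => s' + q = t') (fun q p c => Φ y s' q p c₁ c) _ _ _ _ _ _
    have e₃ : ∀ y s' r (p : s' + (r + a) = t') (c₁ : Chain D.toGrCat y₀ y s')
        (c₂ : Chain D.toGrCat y y₁ r),
        (c₂.lastComp g rfl fun c₂' => Φ y s' (r + a) p c₁ c₂') =
        c₂.lastComp g (by omega) fun c₂' => Φ y s' (r + (a - 1) + 1) (by omega) c₁ c₂' := fun y s' r p c₁ c₂ =>
      lastComp_congr (P := fun q => s' + q = t') (fun q p c => Φ y s' q p c₁ c) _ _ _ _ _ _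
    have sa : ∀ r, sgn k (r + (a - 1)) = sgn k (a - 1) * sgn k r := fun r => by
      rw [sgn_add, mul_comm]
    have ih' := ih rfl fun y s r h c₁ c₂ => Φ y s (r + (a - 1)) (by omega) c₁ (snoc c₂ g rfl)
    have e₄ : ∀ c : Chain D.toGrCat y₀ y₁ (s + 1),
       (snoc c g (by omega) : Chain D.toGrCat y₀ y₂ t').splitSum Φ =
         Φ y₂ t' 0 (add_zero _) (snoc c g (by omega)) (nil _) +
          c.splitSum fun y s r h c₁ c₂ =>
            Φ y s (r + (a - 1)) (by omega) c₁ (snoc c₂ g rfl) := fun c => by rw [splitSum]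
    have e₅ : (snoc c (D.d rfl g) (by omega) : Chain D.toGrCat y₀ y₂ t').splitSum Φ =
         Φ y₂ t' 0 (add_zero _) (snoc c (D.d rfl g) (by omega)) (nil _) +
          c.splitSum fun y s r h c₁ c₂ =>
            Φ y s (r + (a + 1 - 1)) (by omega) c₁ (snoc c₂ (D.d rfl g) rfl) := by rw [splitSum]
    subst ht
    simp only [barSum, key, e₄, e₅, barSum_add]
    rw [ih']
    simp only [splitSum, barSum, e₁, e₂, e₃, splitSum_add, splitSum_smul, smul_add, sgn_zero,
      one_smul, zero_add, sa, mul_smul, splitSum_neg]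
    abel

theorem barSum_apply {y₀ y : D.Obj} {t t' : ℤ} (c : Chain D.toGrCat y₀ y t)
    (h : t + 1 = t') (Φ : Chain D.toGrCat y₀ y t' → M →ₗ[k] N) (x : M) :
    (c.barSum h Φ) x = c.barSum h fun c => Φ c x :=
  barSum_map (LinearMap.applyₗ x) c h Φ

theorem barSum_congr {y₀ y₁ : D.Obj} {t q q' : ℤ} {P : ℤ → Prop}
    (Φ : ∀ q : ℤ, P q → Chain D.toGrCat y₀ y₁ q → M) (c : Chain D.toGrCat y₀ y₁ t)
    (hq : t + 1 = q) (hq' : t + 1 = q') (p : P q) (p' : P q') :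
    (c.barSum hq fun c => Φ q p c) = c.barSum hq' fun c => Φ q' p' c := by
  subst hq hq'; rfl

theorem MultiLin.neg_last {D : GrCat k} {y₀ y y' : D.Obj} {s a t : ℤ} (c : Chain D y₀ y s)
    (g : D.Hom y y' a) (h : s + (a - 1) = t)
    (Φ : Chain D y₀ y' t → M) (hΦ : MultiLin Φ) : Φ (snoc c (-g) h) = -Φ (snoc c g h) := by
  have := hΦ (-1) _ _ _ (LinComb.here c g 0 h)
  rw [MultiLin.zero_last c h Φ hΦ] at this
  simpa using this

theorem snoc_comp_congr {D : GrCat k} {M : Type u} {y₀ y y' z : D.Obj} {s a b p p' t : ℤ}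
    (Φ : Chain D y₀ z t → M) (c : Chain D y₀ y s) (f : D.Hom y' z a) (g : D.Hom y y' b)
    (h : a + b = p) (h' : a + b = p') (hp : s + (p - 1) = t) (hp' : s + (p' - 1) = t) :
    Φ (snoc c (D.comp h f g) hp) = Φ (snoc c (D.comp h' f g) hp') := by
  subst h h'; rfl

/-- The square of the bar differential vanishes. -/
theorem barSum_barSum {y₀ y₁ : D.Obj} {t t' t'' : ℤ} (c : Chain D.toGrCat y₀ y₁ t)
    (h : t + 1 = t') (h' : t' + 1 = t'') (Φ : Chain D.toGrCat y₀ y₁ t'' → M) (hΦ : MultiLin Φ) :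
    (c.barSum h fun c' => c'.barSum h' Φ) = 0 := by
  induction c generalizing t' t'' with
  | nil => simp [barSum]
  | @snoc y₁ y₂ s a t c g hs ih =>
    subst h h'
    have ih' := ih rfl rfl (fun c => Φ (snoc c g (by omega)))
      (fun r c c' c'' hc => hΦ r _ _ _ (LinComb.snoc g (by omega) hc))
    have sa : sgn k (a - 1) = -sgn k a := by rw [sgn_sub, sgn_one]; ring
    have sa' : sgn k (a + 1 - 1) = sgn k a := by rw [add_sub_cancel_right]
    simp only [barSum, barSum_add, barSum_smul, D.d_d, MultiLin.zero_last _ _ Φ hΦ, ih', sa, sa']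
    have key : -c.lastComp (D.d rfl g) (by omega) Φ +
        (c.lastComp (t := t + 1) g (by omega) fun c' => c'.barSum rfl Φ) -
        sgn k a • (c.barSum rfl fun c' => c'.lastComp g (by omega) Φ) = 0 := by
      cases c with
      | nil => simp [barSum, lastComp_nil]
      | @snoc y₁ _ s a' t c g' hs' =>
        subst hs'
        have sb : sgn k (a' - 1) = -sgn k a' := by rw [sgn_sub, sgn_one]; ring
        have sc : sgn k (a + a' - 1) = - (sgn k a * sgn k a') := by
          rw [sgn_sub, sgn_one, sgn_add]; ring
        have sd : sgn k (a + 1) = - sgn k a := by rw [sgn_add, sgn_one]; ring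
        simp only [barSum, lastComp_snoc, sb, sc, sd, barSum_smul]
        have e : c.lastComp (t := s + (a' - 1) + 1) g' (by omega)
              (fun c' => c'.lastComp g (by omega) Φ) =
            c.lastComp (D.comp rfl g g') (by omega) Φ := by
          cases c with
          | nil => simp [lastComp_nil]
          | snoc c g'' h'' =>
            simp only [lastComp_snoc]
            rw [smul_smul, sgn_add, mul_comm,
              D.assoc rfl rfl rfl (add_assoc _ _ _).symm]
            congr 1
            exact snoc_comp_congr Φ _ _ _ _ _ _ _
        have e1 : Φ (snoc c (D.d rfl (D.comp rfl g g')) (by omega)) =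
            Φ (snoc c (D.comp (add_right_comm _ _ _) (D.d rfl g) g') (by omega)) +
            sgn k a • Φ (snoc c (D.comp (add_assoc _ _ _).symm g (D.d rfl g')) (by omega)) := by
          have e0 := (D.leibniz rfl rfl rfl rfl g g').trans (add_comm _ _)
          rw [e0, hΦ _ _ _ _ (LinComb.here c _ _ _), add_comm]
        have e2 : Φ (snoc c (D.comp rfl (D.d rfl g) g') (by omega)) =
            Φ (snoc c (D.comp (add_right_comm _ _ _) (D.d rfl g) g') (by omega)) :=
          snoc_comp_congr Φ _ _ _ _ _ _ _
        have e3 : Φ (snoc c (D.comp rfl g (D.d rfl g')) (by omega)) =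
            Φ (snoc c (D.comp (add_assoc _ _ _).symm g (D.d rfl g')) (by omega)) :=
          snoc_comp_congr Φ _ _ _ _ _ _ _
        rw [e, e1, e2, e3]
        rcases sgn_cases (k := k) a with h1 | h1 <;> rcases sgn_cases (k := k) a' with h2 | h2 <;>
          simp only [h1, h2] <;> module
    have e4 : (c.barSum rfl fun c => -Φ (snoc c (D.d rfl g) (by omega))) =
        -(c.barSum rfl fun c => Φ (snoc c (D.d rfl g) (by omega))) :=
      (barSum_map (-LinearMap.id : M →ₗ[k] M) c rfl _).symm
    rw [e4]
    refine Eq.trans ?_ key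
    rcases sgn_cases (k := k) a with h1 | h1 <;> simp only [h1] <;> module

/-- The terms of the bar differential (corrected by the term in which the first morphism is
removed) for a chain whose last morphism is an identity. -/
theorem barSum_snoc_id {y₀ y₁ : D.Obj} {t s : ℤ} (c : Chain D.toGrCat y₀ y₁ s)
    (hs : s + (0 - 1) = t) (ht : t + 1 = s)
    (Φ : Chain D.toGrCat y₀ y₁ s → M) (hΦ : MultiLin Φ) (hn : ∀ c, HasId c → Φ c = 0)
    (η : ∀ (y : D.Obj) (s r : ℤ), s + r = t → Chain D.toGrCat y₀ y s →
      Chain D.toGrCat y y₁ r → M)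
    (h₁ : ∀ y s r h c₁ c₂, HasId c₂ → η y s r h c₁ c₂ = 0)
    (h₃ : ∀ c₂, η y₀ (-1) s (by omega) (snoc (nil y₀) (D.id y₀) (by omega)) c₂ = sgn k s • Φ c₂)
    (h₄ : ∀ y y' s a t' r (h : s + (a - 1) = t') (h' : t' + r = t) (c₁ : Chain D.toGrCat y₀ y s)
      (g : D.Hom y y' a) c₂, Pos c₁ → η y' t' r h' (snoc c₁ g h) c₂ = 0) :
    (snoc c (D.id y₁) hs).barSum ht Φ + (snoc c (D.id y₁) hs).splitSum η = Φ c := by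
  simp only [barSum, splitSum, h₁ _ _ _ _ _ _ (HasId.here _ rfl), splitSum_zero,
    hn _ (HasId.here _ _), barSum_zero, smul_zero, add_zero]
  have hd : D.d rfl (D.id y₁) = 0 := D.d_id_cast rfl rfl
  rw [hd, MultiLin.zero_last _ _ Φ hΦ]
  cases c with
  | nil =>
    obtain rfl : t = -1 := by omega
    have := h₃ (nil _)
    rw [sgn_zero, one_smul] at this
    rw [lastComp_nil, neg_zero, zero_add, zero_add]
    exact this
  | snoc c g' h' =>
    rw [lastComp_snoc, h₄ _ _ _ _ _ _ _ _ _ _ _ (Pos.snoc _ _ _), sgn_zero, one_smul, neg_zero,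
      zero_add, add_zero, snoc_comp_congr Φ c _ _ rfl (zero_add _) _ h', D.id_comp]

/-- Same, for a chain with an identity at a position that is not the last one. -/
theorem barSum_snoc_hasId {y₀ y₁ y₂ : D.Obj} {a t t' s : ℤ} {c : Chain D.toGrCat y₀ y₁ s}
    (hc : HasId c) (g : D.Hom y₁ y₂ a)
    (hs : s + (a - 1) = t) (ht : t + 1 = t')
    (Φ : Chain D.toGrCat y₀ y₂ t' → M) (hΦ : MultiLin Φ) (hn : ∀ c, HasId c → Φ c = 0)
    (η : ∀ (y : D.Obj) (s r : ℤ), s + r = t → Chain D.toGrCat y₀ y s →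
      Chain D.toGrCat y y₂ r → M)
    (h₁ : ∀ y s r h c₁ c₂, HasId c₂ → η y s r h c₁ c₂ = 0)
    (h₃ : ∀ c₂, η y₀ (-1) t' (by omega) (snoc (nil y₀) (D.id y₀) (by omega)) c₂ = sgn k t' • Φ c₂)
    (h₄ : ∀ y y' s a t' r (h : s + (a - 1) = t') (h' : t' + r = t) (c₁ : Chain D.toGrCat y₀ y s)
      (g : D.Hom y y' a) c₂, Pos c₁ → η y' t' r h' (snoc c₁ g h) c₂ = 0) :
    (snoc c g hs).barSum ht Φ + (snoc c g hs).splitSum η = 0 := by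
  have sa : ∀ a r, sgn k (a - 1) * sgn k (r + (a - 1)) = sgn k r := fun a r => by
    rw [sgn_add, mul_left_comm, sgn_mul_self, mul_one]
  induction hc generalizing y₂ a t t' with
  | @here y s' s c h =>
    obtain rfl : s' = s + 1 := by omega
    have key := barSum_snoc_id c h rfl (fun c => Φ (snoc c g (by omega)))
      (fun r c c' c'' hc => hΦ r _ _ _ (LinComb.snoc g (by omega) hc))
      (fun c hc => hn _ (HasId.snoc g _ hc))
      (fun y s r h c₁ c₂ => sgn k (a - 1) • η y s (r + (a - 1)) (by omega) c₁ (snoc c₂ g rfl))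
      (fun y s r h c₁ c₂ hc => by rw [h₁ _ _ _ _ _ _ (HasId.snoc g rfl hc), smul_zero])
      (fun c₂ => by
        obtain rfl : t' = s + 1 + (a - 1) := by omega
        rw [h₃, smul_smul, sa])
      (fun y y' s b t' r h h' c₁ g' c₂ hc => by rw [h₄ _ _ _ _ _ _ _ _ _ _ _ hc, smul_zero])
    rw [splitSum_smul] at key
    rw [barSum, splitSum, hn _ (HasId.snoc _ _ (HasId.here _ _)), lastComp_snoc,
      h₄ _ _ _ _ _ _ _ _ _ _ _ (Pos.snoc _ _ _),
      snoc_comp_congr Φ c _ _ rfl (add_zero _) _ (by omega), D.comp_id]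
    have e := congrArg (fun z => sgn k (a - 1) • z) key
    simp only [smul_add, smul_smul, sgn_mul_self, one_smul] at e
    rw [zero_add, add_assoc, e, sgn_sub, sgn_one]
    module
  | @snoc y y' s' b s c g' h hc ih =>
    have key := ih g' h rfl (fun c => Φ (snoc c g (by omega)))
      (fun r c c' c'' hc => hΦ r _ _ _ (LinComb.snoc g (by omega) hc))
      (fun c hc => hn _ (HasId.snoc g _ hc))
      (fun y s r h c₁ c₂ => sgn k (a - 1) • η y s (r + (a - 1)) (by omega) c₁ (snoc c₂ g rfl))
      (fun y s r h c₁ c₂ hc => by rw [h₁ _ _ _ _ _ _ (HasId.snoc g rfl hc), smul_zero])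
      (fun c₂ => by
        obtain rfl : t' = s + 1 + (a - 1) := by omega
        rw [h₃, smul_smul, sa])
      (fun y y' s b t' r h h' c₁ g' c₂ hc => by rw [h₄ _ _ _ _ _ _ _ _ _ _ _ hc, smul_zero])
    rw [splitSum_smul] at key
    rw [barSum, splitSum, hn _ (HasId.snoc _ _ (HasId.snoc _ _ hc)), lastComp_snoc,
      h₄ _ _ _ _ _ _ _ _ _ _ _ (Pos.snoc _ _ _), hn _ (HasId.snoc _ _ hc)]
    have e := congrArg (fun z => sgn k (a - 1) • z) key
    simp only [smul_add, smul_smul, sgn_mul_self, one_smul, smul_zero] at e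
    rw [zero_add, add_assoc, e]
    simp

end BarLemmas

end Chain

open Chain

/-! ### Cochains -/

/-- A (not necessarily multilinear) cochain of total degree `p` between object maps `F`, `G`:
a chain `c` from `y₀` to `y₁` is sent to a morphism `F y₀ ⟶ G y₁` of degree
`q = p + ∑ (|g_i| - 1)`. -/
def RawCoch (D E : GrCat k) (F G : D.Obj → E.Obj) (p : ℤ) : Type u :=
  ∀ (y₀ y₁ : D.Obj) (t q : ℤ), p + t = q → Chain D y₀ y₁ t → E.Hom (F y₀) (G y₁) q

namespace RawCoch

instance {D E : GrCat k} (F G : D.Obj → E.Obj) (p : ℤ) : Add (RawCoch D E F G p) where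
  add Ψ Ψ' y₀ y₁ t q h c := Ψ y₀ y₁ t q h c + Ψ' y₀ y₁ t q h c

instance {D E : GrCat k} (F G : D.Obj → E.Obj) (p : ℤ) : Zero (RawCoch D E F G p) where
  zero _ _ _ _ _ _ := 0

instance {D E : GrCat k} (F G : D.Obj → E.Obj) (p : ℤ) : Neg (RawCoch D E F G p) where
  neg Ψ y₀ y₁ t q h c := -Ψ y₀ y₁ t q h c

instance {D E : GrCat k} (F G : D.Obj → E.Obj) (p : ℤ) : AddCommGroup (RawCoch D E F G p) where
  nsmul := nsmulRec
  zsmul := zsmulRec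
  add_assoc _ _ _ := by funext y₀ y₁ t q h c; exact add_assoc _ _ _
  zero_add _ := by funext y₀ y₁ t q h c; exact zero_add _
  add_zero _ := by funext y₀ y₁ t q h c; exact add_zero _
  neg_add_cancel _ := by funext y₀ y₁ t q h c; exact neg_add_cancel _
  add_comm _ _ := by funext y₀ y₁ t q h c; exact add_comm _ _

instance {D E : GrCat k} (F G : D.Obj → E.Obj) (p : ℤ) : Module k (RawCoch D E F G p) where
  smul x Ψ y₀ y₁ t q h c := x • Ψ y₀ y₁ t q h c
  one_smul _ := by funext y₀ y₁ t q h c; exact one_smul _ _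
  mul_smul _ _ _ := by funext y₀ y₁ t q h c; exact SemigroupAction.mul_smul _ _ _
  smul_zero _ := by funext y₀ y₁ t q h c; exact smul_zero _
  smul_add _ _ _ := by funext y₀ y₁ t q h c; exact smul_add _ _ _
  add_smul _ _ _ := by funext y₀ y₁ t q h c; exact add_smul _ _ _
  zero_smul _ := by funext y₀ y₁ t q h c; exact zero_smul _ _

theorem add_apply {D E : GrCat k} {F G : D.Obj → E.Obj} {p : ℤ} (Ψ Ψ' : RawCoch D E F G p)
    (y₀ y₁ : D.Obj) (t q : ℤ) (h : p + t = q) (c : Chain D y₀ y₁ t) :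
    (Ψ + Ψ') y₀ y₁ t q h c = Ψ y₀ y₁ t q h c + Ψ' y₀ y₁ t q h c := rfl

theorem neg_apply {D E : GrCat k} {F G : D.Obj → E.Obj} {p : ℤ} (Ψ : RawCoch D E F G p)
    (y₀ y₁ : D.Obj) (t q : ℤ) (h : p + t = q) (c : Chain D y₀ y₁ t) :
    (-Ψ) y₀ y₁ t q h c = -Ψ y₀ y₁ t q h c := rfl

theorem sub_apply {D E : GrCat k} {F G : D.Obj → E.Obj} {p : ℤ} (Ψ Ψ' : RawCoch D E F G p)
    (y₀ y₁ : D.Obj) (t q : ℤ) (h : p + t = q) (c : Chain D y₀ y₁ t) :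
    (Ψ - Ψ') y₀ y₁ t q h c = Ψ y₀ y₁ t q h c - Ψ' y₀ y₁ t q h c := by
  rw [sub_eq_add_neg, sub_eq_add_neg]; rfl

theorem zero_apply {D E : GrCat k} {F G : D.Obj → E.Obj} {p : ℤ}
    (y₀ y₁ : D.Obj) (t q : ℤ) (h : p + t = q) (c : Chain D y₀ y₁ t) :
    (0 : RawCoch D E F G p) y₀ y₁ t q h c = 0 := rfl

theorem smul_apply {D E : GrCat k} {F G : D.Obj → E.Obj} {p : ℤ} (x : k) (Ψ : RawCoch D E F G p)
    (y₀ y₁ : D.Obj) (t q : ℤ) (h : p + t = q) (c : Chain D y₀ y₁ t) :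
    (x • Ψ) y₀ y₁ t q h c = x • Ψ y₀ y₁ t q h c := rfl

/-- The unit cochain: the identities on chains of length `0`, and zero on longer chains. -/
def one {D E : GrCat k} (F : D.Obj → E.Obj) : RawCoch D E F F 0
  | _, _, _, _, h, nil _ => E.cast h (E.id _)
  | _, _, _, _, _, snoc _ _ _ => 0

/-- The twisting cochain of a graded functor: `F g` on a chain `(g)` of length `1`, and zero on
chains of other lengths. -/
def tau {D E : GrCat k} (F : GrFunctor D E) : RawCoch D E F.obj F.obj 1
  | _, _, _, _, _, nil _ => 0
  | _, _, _, _, h, snoc (nil _) g h' => E.cast (by omega) (F.map g)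
  | _, _, _, _, _, snoc (snoc _ _ _) _ _ => 0

section

variable {D E : GrCat k} {F G H K : D.Obj → E.Obj} {p₁ p₂ p₃ p : ℤ}

/-- The composition of cochains, with the Koszul sign:
`(Ψ₂ * Ψ₁) (g₁, …, gₙ) = ∑_m (-1) ^ (p₁ * ∑_{i > m} (|g_i| - 1)) •
  Ψ₂ (g_{m+1}, …, gₙ) ∘ Ψ₁ (g₁, …, g_m)`, where `p₁` is the degree of `Ψ₁`. -/
def mul (h : p₂ + p₁ = p) (Ψ₂ : RawCoch D E G H p₂) (Ψ₁ : RawCoch D E F G p₁) :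
    RawCoch D E F H p := fun _ _ _ q hq c => c.splitSum fun _ s r hsr c₁ c₂ =>
  sgn k (p₁ * r) • E.comp (m := p₂ + r) (n := p₁ + s) (p := q) (by omega)
    (Ψ₂ _ _ _ _ rfl c₂) (Ψ₁ _ _ _ _ rfl c₁)

theorem mul_add (h : p₂ + p₁ = p) (Ψ₂ : RawCoch D E G H p₂) (Ψ₁ Ψ₁' : RawCoch D E F G p₁) :
    mul h Ψ₂ (Ψ₁ + Ψ₁') = mul h Ψ₂ Ψ₁ + mul h Ψ₂ Ψ₁' := by
  funext y₀ y₁ t q hq c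
  simp only [mul, add_apply, map_add, smul_add, splitSum_add]

theorem add_mul (h : p₂ + p₁ = p) (Ψ₂ Ψ₂' : RawCoch D E G H p₂) (Ψ₁ : RawCoch D E F G p₁) :
    mul h (Ψ₂ + Ψ₂') Ψ₁ = mul h Ψ₂ Ψ₁ + mul h Ψ₂' Ψ₁ := by
  funext y₀ y₁ t q hq c
  simp only [mul, add_apply, map_add, LinearMap.add_apply, smul_add, splitSum_add]

theorem mul_smul (h : p₂ + p₁ = p) (x : k) (Ψ₂ : RawCoch D E G H p₂) (Ψ₁ : RawCoch D E F G p₁) :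
    mul h Ψ₂ (x • Ψ₁) = x • mul h Ψ₂ Ψ₁ := by
  funext y₀ y₁ t q hq c
  simp only [mul, smul_apply, map_smul, smul_comm _ x, splitSum_smul]

theorem smul_mul (h : p₂ + p₁ = p) (x : k) (Ψ₂ : RawCoch D E G H p₂) (Ψ₁ : RawCoch D E F G p₁) :
    mul h (x • Ψ₂) Ψ₁ = x • mul h Ψ₂ Ψ₁ := by
  funext y₀ y₁ t q hq c
  simp only [mul, smul_apply, map_smul, LinearMap.smul_apply, smul_comm _ x, splitSum_smul]

theorem zero_mul (h : p₂ + p₁ = p) (Ψ₁ : RawCoch D E F G p₁) :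
    mul h (0 : RawCoch D E G H p₂) Ψ₁ = 0 := by
  have := smul_mul h (0 : k) (0 : RawCoch D E G H p₂) Ψ₁
  rwa [zero_smul, zero_smul] at this

theorem mul_zero (h : p₂ + p₁ = p) (Ψ₂ : RawCoch D E G H p₂) :
    mul h Ψ₂ (0 : RawCoch D E F G p₁) = 0 := by
  have := mul_smul h (0 : k) Ψ₂ (0 : RawCoch D E F G p₁)
  rwa [zero_smul, zero_smul] at this

theorem mul_assoc {p₃₂ p₂₁ : ℤ} (h₁ : p₃ + p₂ = p₃₂) (h₂ : p₃₂ + p₁ = p) (h₃ : p₂ + p₁ = p₂₁)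
    (h₄ : p₃ + p₂₁ = p) (Ψ₃ : RawCoch D E H K p₃) (Ψ₂ : RawCoch D E G H p₂)
    (Ψ₁ : RawCoch D E F G p₁) : mul h₂ (mul h₁ Ψ₃ Ψ₂) Ψ₁ = mul h₄ Ψ₃ (mul h₃ Ψ₂ Ψ₁) := by
  subst h₁ h₂ h₃
  funext y₀ y₁ t q hq c
  have key := splitSum_assoc c fun y y' s r u h c₁ c₂ c₃ =>
    (sgn k ((p₂ + p₁) * u) * sgn k (p₁ * r)) • E.comp (m := p₃ + u) (n := p₂ + p₁ + (s + r))
      (p := q) (by omega) (Ψ₃ _ _ _ _ rfl c₃)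
      (E.comp (m := p₂ + r) (n := p₁ + s) (by omega) (Ψ₂ _ _ _ _ rfl c₂) (Ψ₁ _ _ _ _ rfl c₁))
  unfold mul
  symm
  refine Eq.trans ?_ (key.trans ?_)
  · congr 1
    funext y s r h c₁₂ c₃
    rw [splitSum_map _ (map_add _), ← splitSum_smul]
    congr 1
    funext y' s' r' h' c₁ c₂
    subst h'
    rw [map_smul, smul_smul]
  · congr 1
    funext y s r h c₁ c₂₃
    rw [splitSum_map _ (map_add _), splitSum_map (fun z : E.Hom (F y₀) (G y) _ →ₗ[k] E.Hom (F y₀) (K y₁) q =>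
        z (Ψ₁ y₀ y s _ rfl c₁)) (fun _ _ => rfl), ← splitSum_smul]
    congr 1
    funext y' s' r' h' c₂ c₃
    subst h'
    rw [map_smul, LinearMap.smul_apply, smul_smul, E.assoc]
    congr 1
    · rw [_root_.add_mul, _root_.mul_add, sgn_add, sgn_add]
      ring
    all_goals omega

theorem splitSum_nil_right {D : GrCat k} {M : Type u} [AddCommGroup M] [Module k M] {y₀ y₁ : D.Obj}
    {t : ℤ} (c : Chain D y₀ y₁ t)
    (Φ : ∀ (y : D.Obj) (s r : ℤ), s + r = t → Chain D y₀ y s → Chain D y y₁ r → M)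
    (hΦ : ∀ y s r h c₁ c₂, Pos c₂ → Φ y s r h c₁ c₂ = 0) :
    c.splitSum Φ = Φ y₁ t 0 (add_zero t) c (nil y₁) := by
  cases c with
  | nil => rw [splitSum]
  | snoc c g h =>
    rw [splitSum]
    simp only [hΦ _ _ _ _ _ _ (Pos.snoc _ _ _), splitSum_zero, add_zero]

theorem splitSum_nil_left {D : GrCat k} {M : Type u} [AddCommGroup M] [Module k M] {y₀ y₁ : D.Obj}
    {t : ℤ} (c : Chain D y₀ y₁ t)
    (Φ : ∀ (y : D.Obj) (s r : ℤ), s + r = t → Chain D y₀ y s → Chain D y y₁ r → M)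
    (hΦ : ∀ y s r h c₁ c₂, Pos c₁ → Φ y s r h c₁ c₂ = 0) :
    c.splitSum Φ = Φ y₀ 0 t (zero_add t) (nil y₀) c := by
  induction c with
  | nil => rw [splitSum]
  | snoc c g h ih =>
    rw [splitSum, hΦ _ _ _ _ _ _ (Pos.snoc _ _ _), zero_add, ih _ fun y s r h c₁ c₂ hc =>
      hΦ _ _ _ _ _ _ hc]
    exact apply_snoc (P := fun q => 0 + q = _) (fun q p c => Φ _ 0 q p (nil _) c) _ _ _ _ _ _

theorem one_pos {F : D.Obj → E.Obj} {y₀ y₁ : D.Obj} {t q : ℤ} (h : 0 + t = q)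
    {c : Chain D y₀ y₁ t} (hc : Pos c) : one (E := E) F y₀ y₁ t q h c = 0 := by
  cases hc; rfl

theorem tau_pos {F : GrFunctor D E} {y₀ y₁ y₂ : D.Obj} {s a t q : ℤ} (h : 1 + t = q)
    {c : Chain D y₀ y₁ s} (hc : Pos c) (g : D.Hom y₁ y₂ a) (h' : s + (a - 1) = t) :
    tau F y₀ y₂ t q h (snoc c g h') = 0 := by
  cases hc; rfl

theorem one_mul (h : 0 + p = p) (Ψ : RawCoch D E F G p) : mul h (one G) Ψ = Ψ := by
  funext y₀ y₁ t q hq c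
  subst hq
  unfold mul
  rw [splitSum_nil_right]
  · rw [MulZeroClass.mul_zero, sgn_zero, one_smul]
    exact (E.cast_id_comp rfl _ _).trans rfl
  · intro y s r h c₁ c₂ hc
    rw [one_pos _ hc, map_zero, LinearMap.zero_apply, smul_zero]

theorem mul_one (h : p + 0 = p) (Ψ : RawCoch D E F G p) : mul h Ψ (one F) = Ψ := by
  funext y₀ y₁ t q hq c
  subst hq
  unfold mul
  rw [splitSum_nil_left]
  · rw [MulZeroClass.zero_mul, sgn_zero, one_smul]
    exact (E.comp_cast_id rfl _ _).trans rfl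
  · intro y s r h c₁ c₂ hc
    rw [one_pos _ hc, map_zero, smul_zero]

/-- The cochain is linear in each morphism of the chain. -/
def IsMultiLin (Ψ : RawCoch D E F G p) : Prop :=
  ∀ y₀ y₁ t q h, MultiLin (Ψ y₀ y₁ t q h)

/-- The cochain vanishes on the chains that contain an identity morphism. -/
def IsNormal (Ψ : RawCoch D E F G p) : Prop :=
  ∀ y₀ y₁ t q h c, HasId c → Ψ y₀ y₁ t q h c = 0

theorem IsMultiLin.one (F : D.Obj → E.Obj) : (one (D := D) (E := E) F).IsMultiLin := by
  intro y₀ y₁ t q h r c c₁ c₂ hc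
  cases hc <;> simp [RawCoch.one]

theorem IsMultiLin.tau (F : GrFunctor D E) : (tau F).IsMultiLin := by
  intro y₀ y₁ t q h r c c₁ c₂ hc
  cases hc with
  | here c g₁ g₂ h' =>
    cases c with
    | nil =>
      simp only [RawCoch.tau, map_add, map_smul, E.cast_add, E.cast_smul]
    | snoc c g' h'' => simp [RawCoch.tau]
  | snoc g h' hc => cases hc <;> simp [RawCoch.tau]

theorem IsNormal.one (F : D.Obj → E.Obj) : (one (D := D) (E := E) F).IsNormal := by
  intro y₀ y₁ t q h c hc
  cases hc <;> rfl

theorem IsMultiLin.mul {h : p₂ + p₁ = p} {Ψ₂ : RawCoch D E G H p₂} {Ψ₁ : RawCoch D E F G p₁}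
    (h₂ : Ψ₂.IsMultiLin) (h₁ : Ψ₁.IsMultiLin) : (mul h Ψ₂ Ψ₁).IsMultiLin := by
  intro y₀ y₁ t q hq
  apply splitSum_multiLin
  · intro y s r hsr c₂ x c c' c'' hc
    simp only [h₁ _ _ _ _ rfl x _ _ _ hc, map_add, map_smul, smul_add, smul_comm x]
  · intro y s r hsr c₁ x c c' c'' hc
    simp only [h₂ _ _ _ _ rfl x _ _ _ hc, map_add, map_smul, LinearMap.add_apply,
      LinearMap.smul_apply, smul_add, smul_comm x]

theorem IsNormal.mul {h : p₂ + p₁ = p} {Ψ₂ : RawCoch D E G H p₂} {Ψ₁ : RawCoch D E F G p₁}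
    (h₂ : Ψ₂.IsNormal) (h₁ : Ψ₁.IsNormal) : (mul h Ψ₂ Ψ₁).IsNormal := by
  intro y₀ y₁ t q hq c hc
  apply splitSum_hasId hc
  · intro y s r hsr c₁ c₂ hc
    rw [h₁ _ _ _ _ rfl _ hc, map_zero, smul_zero]
  · intro y s r hsr c₁ c₂ hc
    rw [h₂ _ _ _ _ rfl _ hc, map_zero, LinearMap.zero_apply, smul_zero]

end

/-- A derivation of degree `1` of a graded category (of square zero or not). -/
structure _root_.DG.GrDer (E : GrCat k) where
  d : ∀ {X Y : E.Obj} {m n : ℤ}, m + 1 = n → E.Hom X Y m →ₗ[k] E.Hom X Y n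
  leibniz : ∀ {X Y Z : E.Obj} {m n p m' n' p' : ℤ} (h : m + n = p) (hm : m + 1 = m')
    (hn : n + 1 = n') (hp : p + 1 = p') (f : E.Hom Y Z m) (g : E.Hom X Y n),
    d hp (E.comp h f g) =
      E.comp (by omega) (d hm f) g + sgn k m • E.comp (by omega) f (d hn g)

theorem _root_.DG.GrDer.comp_d_left {E : GrCat k} (δ : GrDer E) {X Y Z : E.Obj} {m n p a a' : ℤ}
    (h : m + 1 = a) (h' : m + 1 = a') (hp : a + n = p) (hp' : a' + n = p) (f : E.Hom Y Z m)
    (g : E.Hom X Y n) : E.comp hp (δ.d h f) g = E.comp hp' (δ.d h' f) g := by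
  subst h h'; rfl

theorem _root_.DG.GrDer.comp_d_right {E : GrCat k} (δ : GrDer E) {X Y Z : E.Obj} {m n p a a' : ℤ}
    (h : m + 1 = a) (h' : m + 1 = a') (hp : n + a = p) (hp' : n + a' = p) (f : E.Hom Y Z n)
    (g : E.Hom X Y m) : E.comp hp f (δ.d h g) = E.comp hp' f (δ.d h' g) := by
  subst h h'; rfl

/-- The differential of a dg category, as a derivation. -/
def _root_.DG.DGCat.der (E : DGCat k) : GrDer E.toGrCat where
  d := E.d
  leibniz := E.leibniz

section

variable {D : DGCat k} {E : GrCat k} {F G H : D.Obj → E.Obj} {p₁ p₂ p p' p'' : ℤ}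

/-- Application of a derivation of the target to the values of a cochain. -/
def post (δ : GrDer E) (hp : p + 1 = p') (Ψ : RawCoch D.toGrCat E F G p) :
    RawCoch D.toGrCat E F G p' := fun _ _ t _ h c =>
  δ.d (m := p + t) (by omega) (Ψ _ _ _ _ rfl c)

/-- Composition of a cochain with the bar differential. -/
def bar (hp : p + 1 = p') (Ψ : RawCoch D.toGrCat E F G p) : RawCoch D.toGrCat E F G p' :=
  fun _ _ _ _ h c => c.barSum rfl fun c' => Ψ _ _ _ _ (by omega) c'

theorem comp_congr {y₀ y y₁ : D.Obj} {s r q₂ q₁ q₂' q₁' q : ℤ} (Ψ₂ : RawCoch D.toGrCat E G H p₂)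
    (Ψ₁ : RawCoch D.toGrCat E F G p₁) (h₂ : p₂ + r = q₂) (h₂' : p₂ + r = q₂') (h₁ : p₁ + s = q₁)
    (h₁' : p₁ + s = q₁') (h : q₂ + q₁ = q) (h' : q₂' + q₁' = q) (c₁ : Chain D.toGrCat y₀ y s)
    (c₂ : Chain D.toGrCat y y₁ r) :
    E.comp h (Ψ₂ _ _ _ _ h₂ c₂) (Ψ₁ _ _ _ _ h₁ c₁) =
      E.comp h' (Ψ₂ _ _ _ _ h₂' c₂) (Ψ₁ _ _ _ _ h₁' c₁) := by
  subst h₂ h₂' h₁ h₁'; rfl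

theorem mul_apply (h : p₂ + p₁ = p) (Ψ₂ : RawCoch D.toGrCat E G H p₂)
    (Ψ₁ : RawCoch D.toGrCat E F G p₁) {y₀ y₁ : D.Obj} {t q : ℤ} (hq : p + t = q)
    (c : Chain D.toGrCat y₀ y₁ t) :
    mul h Ψ₂ Ψ₁ y₀ y₁ t q hq c = c.splitSum fun _ s r hsr c₁ c₂ =>
      sgn k (p₁ * r) • E.comp (m := p₂ + r) (n := p₁ + s) (p := q) (by omega)
        (Ψ₂ _ _ _ _ rfl c₂) (Ψ₁ _ _ _ _ rfl c₁) := rfl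

theorem bar_apply (hp : p + 1 = p') (Ψ : RawCoch D.toGrCat E F G p) {y₀ y₁ : D.Obj} {t q : ℤ}
    (hq : p' + t = q) (c : Chain D.toGrCat y₀ y₁ t) :
    bar hp Ψ y₀ y₁ t q hq c = c.barSum rfl fun c' => Ψ _ _ _ _ (by omega) c' := rfl

theorem post_apply (δ : GrDer E) (hp : p + 1 = p') (Ψ : RawCoch D.toGrCat E F G p) {y₀ y₁ : D.Obj}
    {t q : ℤ} (hq : p' + t = q) (c : Chain D.toGrCat y₀ y₁ t) :
    post δ hp Ψ y₀ y₁ t q hq c = δ.d (m := p + t) (by omega) (Ψ _ _ _ _ rfl c) := rfl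

theorem d_congr (δ : GrDer E) (Ψ : RawCoch D.toGrCat E F G p) {y₀ y₁ : D.Obj} {t q r r' : ℤ}
    (h : p + t = r) (h' : p + t = r') (hr : r + 1 = q) (hr' : r' + 1 = q)
    (c : Chain D.toGrCat y₀ y₁ t) :
    δ.d hr (Ψ _ _ _ _ h c) = δ.d hr' (Ψ _ _ _ _ h' c) := by
  subst h h'; rfl

theorem IsMultiLin.bar {hp : p + 1 = p'} {Ψ : RawCoch D.toGrCat E F G p} (h : Ψ.IsMultiLin) :
    (bar hp Ψ).IsMultiLin := by
  intro y₀ y₁ t q hq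
  exact barSum_multiLin rfl _ (h _ _ _ _ _)

theorem bar_add (hp : p + 1 = p') (Ψ Ψ' : RawCoch D.toGrCat E F G p) :
    bar hp (Ψ + Ψ') = bar hp Ψ + bar hp Ψ' := by
  funext y₀ y₁ t q hq c
  exact barSum_add _ _ _ _

theorem bar_smul (hp : p + 1 = p') (x : k) (Ψ : RawCoch D.toGrCat E F G p) :
    bar hp (x • Ψ) = x • bar hp Ψ := by
  funext y₀ y₁ t q hq c
  exact barSum_smul _ _ _ _

theorem bar_bar (hp : p + 1 = p') (hp' : p' + 1 = p'') (Ψ : RawCoch D.toGrCat E F G p)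
    (hΨ : Ψ.IsMultiLin) : bar hp' (bar hp Ψ) = 0 := by
  funext y₀ y₁ t q hq c
  exact barSum_barSum c rfl rfl _ (hΨ _ _ _ _ _)

theorem bar_mul {p₁' p₂' : ℤ} (h : p₂ + p₁ = p) (hp : p + 1 = p') (h₁ : p₁ + 1 = p₁')
    (h₂ : p₂ + 1 = p₂') (Ψ₂ : RawCoch D.toGrCat E G H p₂) (Ψ₁ : RawCoch D.toGrCat E F G p₁) :
    bar hp (mul h Ψ₂ Ψ₁) = sgn k p₁ • mul (by omega) (bar h₂ Ψ₂) Ψ₁ +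
      mul (by omega) Ψ₂ (bar h₁ Ψ₁) := by
  subst h h₁ h₂ hp
  funext y₀ y₁ t q hq c
  rw [add_apply, smul_apply, mul_apply, mul_apply, bar_apply]
  simp only [mul_apply]
  refine (barSum_splitSum c rfl _).trans ?_
  rw [splitSum_add, ← splitSum_smul]
  congr 2
  · funext y s r hsr c₁ c₂
    rw [barSum_smul, bar_apply, barSum_map, smul_smul, barSum_apply]
    congr 1
    · rw [_root_.mul_add, sgn_add, _root_.mul_one, mul_comm]
    · congr 1
      funext c₂'
      exact comp_congr Ψ₂ Ψ₁ _ _ _ _ _ _ _ _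
  · funext y s r hsr c₁ c₂
    rw [barSum_smul, bar_apply, barSum_map, smul_smul]
    congr 1
    · rw [_root_.add_mul, sgn_add, _root_.one_mul, mul_comm]
    · congr 1
      funext c₁'
      exact comp_congr Ψ₂ Ψ₁ _ _ _ _ _ _ _ _

theorem post_add (δ : GrDer E) (hp : p + 1 = p') (Ψ Ψ' : RawCoch D.toGrCat E F G p) :
    post δ hp (Ψ + Ψ') = post δ hp Ψ + post δ hp Ψ' := by
  funext y₀ y₁ t q hq c
  exact map_add _ _ _

theorem post_smul (δ : GrDer E) (hp : p + 1 = p') (x : k) (Ψ : RawCoch D.toGrCat E F G p) :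
    post δ hp (x • Ψ) = x • post δ hp Ψ := by
  funext y₀ y₁ t q hq c
  exact map_smul _ _ _

theorem IsMultiLin.post {δ : GrDer E} {hp : p + 1 = p'} {Ψ : RawCoch D.toGrCat E F G p}
    (h : Ψ.IsMultiLin) : (post δ hp Ψ).IsMultiLin := by
  intro y₀ y₁ t q hq x c c₁ c₂ hc
  simp only [RawCoch.post, h _ _ _ _ _ x _ _ _ hc, map_add, map_smul]

theorem IsNormal.post {δ : GrDer E} {hp : p + 1 = p'} {Ψ : RawCoch D.toGrCat E F G p}
    (h : Ψ.IsNormal) : (post δ hp Ψ).IsNormal := by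
  intro y₀ y₁ t q hq c hc
  simp only [RawCoch.post, h _ _ _ _ _ _ hc, map_zero]

theorem post_bar (δ : GrDer E) (hp : p + 1 = p') (hp' : p' + 1 = p'')
    (Ψ : RawCoch D.toGrCat E F G p) : post δ hp' (bar hp Ψ) = bar hp' (post δ hp Ψ) := by
  subst hp
  funext y₀ y₁ t q hq c
  rw [post_apply, bar_apply, bar_apply, barSum_map]
  congr 1
  funext c'
  exact d_congr δ Ψ _ _ _ _ _

theorem post_mul {p₁' p₂' : ℤ} (δ : GrDer E) (h : p₂ + p₁ = p) (hp : p + 1 = p') (h₁ : p₁ + 1 = p₁')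
    (h₂ : p₂ + 1 = p₂') (Ψ₂ : RawCoch D.toGrCat E G H p₂) (Ψ₁ : RawCoch D.toGrCat E F G p₁) :
    post δ hp (mul h Ψ₂ Ψ₁) = mul (by omega) (post δ h₂ Ψ₂) Ψ₁ +
      sgn k p₂ • mul (by omega) Ψ₂ (post δ h₁ Ψ₁) := by
  subst h h₁ h₂ hp
  funext y₀ y₁ t q hq c
  rw [add_apply, smul_apply, post_apply, mul_apply, mul_apply, mul_apply]
  rw [splitSum_map _ (map_add _), ← splitSum_smul, ← splitSum_add]
  congr 1
  funext y s r hsr c₁ c₂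
  rw [map_smul, δ.leibniz _ rfl rfl, smul_add, smul_smul, smul_smul]
  congr 1
  · congr 1
    exact δ.comp_d_left _ _ _ _ _ _
  · congr 1
    · rw [_root_.add_mul, sgn_add, sgn_add, _root_.one_mul]
      rcases sgn_cases (k := k) r with h1 | h1 <;> rw [h1] <;> ring
    · exact δ.comp_d_right _ _ _ _ _ _

theorem tau_nil (F : GrFunctor D.toGrCat E) {y : D.Obj} {q : ℤ} (h : 1 + 0 = q) :
    tau F y y 0 q h (nil y) = 0 := rfl

theorem tau_single (F : GrFunctor D.toGrCat E) {y y' : D.Obj} {a t q : ℤ} (h : 1 + t = q)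
    (g : D.Hom y y' a) (h' : 0 + (a - 1) = t) :
    tau F y y' t q h (snoc (nil y) g h') = E.cast (by omega) (F.map g) := rfl

theorem tau_snoc_snoc (F : GrFunctor D.toGrCat E) {y₀ y y' y'' : D.Obj} {a a' s s' t q : ℤ}
    (h : 1 + t = q) (c : Chain D.toGrCat y₀ y s) (g : D.Hom y y' a) (h' : s + (a - 1) = s')
    (g' : D.Hom y' y'' a') (h'' : s' + (a' - 1) = t) :
    tau F y₀ y'' t q h (snoc (snoc c g h') g' h'') = 0 := rfl

theorem _root_.DG.GrDer.d_cast {E : GrCat k} (δ : GrDer E) {X Y : E.Obj} {m n p : ℤ}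
    (h : m = n) (h' : n + 1 = p) (f : E.Hom X Y m) :
    δ.d h' (E.cast h f) = δ.d (by omega) f := by
  subst h; rfl

theorem _root_.DG.GrDer.cast_d {E : GrCat k} (δ : GrDer E) {X Y : E.Obj} {m n p : ℤ}
    (h : n = p) (h' : m + 1 = n) (f : E.Hom X Y m) :
    E.cast h (δ.d h' f) = δ.d (by omega) f := by
  subst h; rfl

/-- The Maurer–Cartan equation for the twisting cochain of a functor. -/
theorem maurerCartan (δ : GrDer E) (F : GrFunctor D.toGrCat E)
    (hF : ∀ {X Y : D.Obj} {m n : ℤ} (h : m + 1 = n) (f : D.Hom X Y m),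
      F.map (D.d h f) = δ.d h (F.map f)) :
    (bar (p' := 2) rfl (tau F) + mul (p := 2) rfl (tau F) (tau F)) +
      post δ (p' := 2) rfl (tau F) = 0 := by
  funext y₀ y₁ t q hq c
  rw [add_apply, add_apply, zero_apply, bar_apply, mul_apply, post_apply]
  cases c with
  | nil => simp [barSum, splitSum, tau_nil]
  | @snoc y _ s a _ c g h =>
    cases c with
    | nil =>
      simp only [barSum, splitSum, tau_nil, tau_single, lastComp_nil, map_zero,
        LinearMap.zero_apply, smul_zero, add_zero, hF, δ.d_cast, δ.cast_d, neg_add_cancel]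
    | @snoc y' _ s' a' _ c g' h' =>
      cases c with
      | nil =>
        simp only [barSum, splitSum, tau_nil, tau_single, tau_snoc_snoc, lastComp_nil,
          lastComp_snoc, map_zero,
          LinearMap.zero_apply, smul_zero, add_zero, zero_add, neg_zero]
        rw [E.comp_cast _ _ _ rfl, F.map_comp rfl, _root_.one_mul, sgn_sub, sgn_one]
        rw [mul_neg_one, neg_smul, add_neg_cancel]
      | snoc c g'' h'' =>
        simp only [barSum, splitSum, tau_nil, tau_snoc_snoc, lastComp_snoc, map_zero,
          LinearMap.zero_apply, smul_zero, add_zero, neg_zero, barSum_zero, splitSum_zero]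

/-- The part of the differential of a cochain that does not involve the differential of the
target: `τ_G * Ψ - (-1) ^ p • Ψ * τ_F - (-1) ^ p • Ψ ∘ b`, with `b` the bar differential. -/
def hoch (F G : GrFunctor D.toGrCat E) (hp : p + 1 = p')
    (Ψ : RawCoch D.toGrCat E F.obj G.obj p) : RawCoch D.toGrCat E F.obj G.obj p' :=
  mul (by omega) (tau G) Ψ - sgn k p • mul hp Ψ (tau F) - sgn k p • bar hp Ψ

variable {F G H : GrFunctor D.toGrCat E}

theorem hoch_add (hp : p + 1 = p') (Ψ Ψ' : RawCoch D.toGrCat E F.obj G.obj p) :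
    hoch F G hp (Ψ + Ψ') = hoch F G hp Ψ + hoch F G hp Ψ' := by
  simp only [hoch, mul_add, add_mul, bar_add, smul_add]
  abel

theorem hoch_smul (hp : p + 1 = p') (x : k) (Ψ : RawCoch D.toGrCat E F.obj G.obj p) :
    hoch F G hp (x • Ψ) = x • hoch F G hp Ψ := by
  simp only [hoch, mul_smul, smul_mul, bar_smul, smul_sub, smul_comm x]

theorem IsMultiLin.add {F G : D.Obj → E.Obj} {Ψ Ψ' : RawCoch D.toGrCat E F G p}
    (h : Ψ.IsMultiLin) (h' : Ψ'.IsMultiLin) : (Ψ + Ψ').IsMultiLin := by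
  intro y₀ y₁ t q hq x c c₁ c₂ hc
  simp only [add_apply, h _ _ _ _ _ x _ _ _ hc, h' _ _ _ _ _ x _ _ _ hc, smul_add]
  abel

theorem IsMultiLin.smul {F G : D.Obj → E.Obj} {Ψ : RawCoch D.toGrCat E F G p} (r : k)
    (h : Ψ.IsMultiLin) : (r • Ψ).IsMultiLin := by
  intro y₀ y₁ t q hq x c c₁ c₂ hc
  simp only [smul_apply, h _ _ _ _ _ x _ _ _ hc, smul_add, smul_comm x]

theorem IsMultiLin.sub {F G : D.Obj → E.Obj} {Ψ Ψ' : RawCoch D.toGrCat E F G p}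
    (h : Ψ.IsMultiLin) (h' : Ψ'.IsMultiLin) : (Ψ - Ψ').IsMultiLin := by
  have := h.add (h'.smul (-1))
  rwa [neg_smul, _root_.one_smul, ← sub_eq_add_neg] at this

theorem IsMultiLin.hoch {hp : p + 1 = p'} {Ψ : RawCoch D.toGrCat E F.obj G.obj p}
    (h : Ψ.IsMultiLin) : (hoch F G hp Ψ).IsMultiLin :=
  (((IsMultiLin.tau G).mul h).sub ((h.mul (IsMultiLin.tau F)).smul _)).sub (h.bar.smul _)

theorem hoch_mul {p₁' p₂' : ℤ} (h : p₂ + p₁ = p) (hp : p + 1 = p') (h₁ : p₁ + 1 = p₁')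
    (h₂ : p₂ + 1 = p₂') (Ψ₂ : RawCoch D.toGrCat E G.obj H.obj p₂)
    (Ψ₁ : RawCoch D.toGrCat E F.obj G.obj p₁) :
    hoch F H hp (mul h Ψ₂ Ψ₁) = mul (by omega) (hoch G H h₂ Ψ₂) Ψ₁ +
      sgn k p₂ • mul (by omega) Ψ₂ (hoch F G h₁ Ψ₁) := by
  have e₁ : mul (p := p') (p₂ := p₂') (by omega) (mul (p₂ := 1) (by omega) (tau H) Ψ₂) Ψ₁ =
    mul (p₂ := 1) (by omega) (tau H) (mul h Ψ₂ Ψ₁) := mul_assoc _ _ _ _ _ _ _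
  have e₂ : mul (p := p') (p₂ := p₂') (by omega) (mul (p₁ := 1) (by omega) Ψ₂ (tau G)) Ψ₁ =
    mul (p₁ := p₁') (by omega) Ψ₂ (mul (p₂ := 1) (by omega) (tau G) Ψ₁) := mul_assoc _ _ _ _ _ _ _
  have e₃ : mul (p := p') (p₁ := 1) (by omega) (mul h Ψ₂ Ψ₁) (tau F) =
    mul (p₁ := p₁') (by omega) Ψ₂ (mul (p₁ := 1) (by omega) Ψ₁ (tau F)) := mul_assoc _ _ _ _ _ _ _
  simp only [hoch, bar_mul h hp h₁ h₂, sub_eq_add_neg, ← neg_smul, mul_add, add_mul, mul_smul,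
    smul_mul, e₁, e₂, e₃, smul_add]
  subst h
  rw [sgn_add]
  rcases sgn_cases (k := k) p₁ with h | h <;> rcases sgn_cases (k := k) p₂ with h' | h' <;>
    simp only [h, h'] <;> module

theorem barSum_pos {M : Type u} [AddCommGroup M] [Module k M] {y₀ y : D.Obj} {t t' : ℤ}
    (c : Chain D.toGrCat y₀ y t) (h : t + 1 = t') (Φ : Chain D.toGrCat y₀ y t' → M)
    (hΦ : ∀ c, Pos c → Φ c = 0) : c.barSum h Φ = 0 := by
  cases c with
  | nil => rw [barSum]
  | snoc c g h' =>
    rw [barSum, hΦ _ (Pos.snoc _ _ _)]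
    simp only [hΦ _ (Pos.snoc _ _ _), barSum_zero]
    cases c with
    | nil => simp [lastComp_nil]
    | snoc c g' h'' => simp [lastComp_snoc, hΦ _ (Pos.snoc _ _ _)]

theorem tau_mul_snoc (h : 1 + p = p') (Ψ : RawCoch D.toGrCat E F.obj G.obj p) {y₀ y y' : D.Obj}
    {s a t q : ℤ} (c : Chain D.toGrCat y₀ y s) (g : D.Hom y y' a) (ht : s + (a - 1) = t)
    (hq : p' + t = q) : RawCoch.mul h (tau G) Ψ y₀ y' t q hq (snoc c g ht) =
      sgn k (p * (a - 1)) • E.comp (by omega) (G.map g) (Ψ y₀ y s (p + s) rfl c) := by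
  rw [mul_apply, splitSum, tau_nil, map_zero, LinearMap.zero_apply, smul_zero, zero_add,
    splitSum_nil_right]
  · rw [tau_single, E.cast_comp]
    congr 2
    rw [zero_add]
  · intro y s r h c₁ c₂ hc
    rw [tau_pos _ hc, map_zero, LinearMap.zero_apply, smul_zero]

theorem hoch_one : hoch F F (p' := 1) rfl (one F.obj) = 0 := by
  have e : bar (D := D) (p' := 1) rfl (one (E := E) F.obj) = 0 := by
    funext y₀ y₁ t q hq c
    exact barSum_pos _ _ _ fun c hc => one_pos _ hc
  rw [hoch, one_mul, mul_one, e]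
  simp

theorem hoch_hoch (hp : p + 1 = p') (hp' : p' + 1 = p'') (Ψ : RawCoch D.toGrCat E F.obj G.obj p)
    (hΨ : Ψ.IsMultiLin) : hoch F G hp' (hoch F G hp Ψ) =
      mul (by omega) (bar (p' := 2) rfl (tau G) + mul (p := 2) rfl (tau G) (tau G)) Ψ -
      mul (by omega) Ψ (bar (p' := 2) rfl (tau F) + mul (p := 2) rfl (tau F) (tau F)) := by
  have e₁ : mul (p := p'') (p₁ := p') (by omega) (tau G) (mul (p₂ := 1) (by omega) (tau G) Ψ) =
    mul (p₂ := 2) (by omega) (mul rfl (tau G) (tau G)) Ψ := (mul_assoc _ _ _ _ _ _ _).symm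
  have e₂ : mul (p := p'') (p₁ := p') (by omega) (tau G) (mul (p₁ := 1) (by omega) Ψ (tau F)) =
    mul (p₂ := p') (by omega) (mul (p₂ := 1) (by omega) (tau G) Ψ) (tau F) :=
      (mul_assoc _ _ _ _ _ _ _).symm
  have e₃ : mul (p := p'') (p₂ := p') (by omega) (mul (p₁ := 1) (by omega) Ψ (tau F)) (tau F) =
    mul (p₁ := 2) (by omega) Ψ (mul rfl (tau F) (tau F)) := mul_assoc _ _ _ _ _ _ _
  have e₄ := bar_mul (p₂ := 1) (p := p') (by omega) hp' hp (p₂' := 2) rfl (tau G) Ψ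
  have e₅ := bar_mul (p₁ := 1) (p := p') hp hp' (p₁' := 2) rfl hp Ψ (tau F)
  have e₆ := bar_bar hp hp' Ψ hΨ
  simp only [hoch, sub_eq_add_neg, ← neg_smul, mul_add, add_mul, mul_smul, bar_add, bar_smul,
    smul_mul, e₁, e₂, e₃, e₄, e₅, e₆, smul_add, smul_zero]
  subst hp
  rw [sgn_add, sgn_one]
  rcases sgn_cases (k := k) p with h | h <;> simp only [h] <;> module

theorem post_hoch (δ : GrDer E) (hp : p + 1 = p') (hp' : p' + 1 = p'')
    (Ψ : RawCoch D.toGrCat E F.obj G.obj p) :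
    post δ hp' (hoch F G hp Ψ) = -hoch F G hp' (post δ hp Ψ) +
      mul (by omega) (post δ (p' := 2) rfl (tau G)) Ψ -
      mul (by omega) Ψ (post δ (p' := 2) rfl (tau F)) := by
  have e₁ := post_mul δ (p₂ := 1) (p := p') (by omega) hp' hp (p₂' := 2) rfl (tau G) Ψ
  have e₂ := post_mul δ (p₁ := 1) (p := p') hp hp' (p₁' := 2) rfl hp Ψ (tau F)
  simp only [hoch, sub_eq_add_neg, ← neg_smul, post_add, post_smul, post_bar δ hp hp', e₁, e₂]
  subst hp
  rw [sgn_add, sgn_one]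
  rcases sgn_cases (k := k) p with h | h <;> simp only [h] <;> module

theorem IsNormal.hoch {hp : p + 1 = p'} {Ψ : RawCoch D.toGrCat E F.obj G.obj p}
    (hm : Ψ.IsMultiLin) (h : Ψ.IsNormal) : (hoch F G hp Ψ).IsNormal := by
  subst hp
  intro y₀ y₁ t q hq c hc
  have key : RawCoch.mul (p := p + 1) (by omega) (tau G) Ψ y₀ y₁ t q hq c =
      sgn k p • (RawCoch.mul rfl Ψ (tau F) y₀ y₁ t q hq c + RawCoch.bar rfl Ψ y₀ y₁ t q hq c) := by
    have h₁ : ∀ (y : D.Obj) (s r : ℤ) (hsr : s + r = t) (c₁ : Chain D.toGrCat y₀ y s)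
        (c₂ : Chain D.toGrCat y y₁ r), HasId c₂ →
        sgn k (1 * r) • E.comp (m := p + r) (n := 1 + s) (p := q) (by omega)
          (Ψ _ _ _ _ rfl c₂) (tau F _ _ _ _ rfl c₁) = 0 := by
      intro y s r hsr c₁ c₂ hc
      rw [h _ _ _ _ _ _ hc, map_zero, LinearMap.zero_apply, smul_zero]
    have h₄ : ∀ y y' s a t' r (hs : s + (a - 1) = t') (h' : t' + r = t)
        (c₁ : Chain D.toGrCat y₀ y s) (g : D.Hom y y' a) (c₂ : Chain D.toGrCat y' y₁ r), Pos c₁ →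
        sgn k (1 * r) • E.comp (m := p + r) (n := 1 + t') (p := q) (by omega)
          (Ψ _ _ _ _ rfl c₂) (tau F _ _ _ _ rfl (snoc c₁ g hs)) = 0 := by
      intro y y' s a t' r hs h' c₁ g c₂ hc
      rw [tau_pos _ hc, map_zero, smul_zero]
    have h₃ : ∀ c₂ : Chain D.toGrCat y₀ y₁ (t + 1),
        sgn k (1 * (t + 1)) • E.comp (m := p + (t + 1)) (n := 1 + -1) (p := q) (by omega)
          (Ψ _ _ _ _ rfl c₂) (tau F _ _ _ _ rfl (snoc (nil y₀) (D.id y₀) (by omega))) =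
        sgn k (t + 1) • Ψ _ _ _ _ (by omega) c₂ := by
      intro c₂
      obtain rfl : p + (t + 1) = q := by omega
      rw [tau_single, F.map_id, E.comp_cast_id, E.cast_rfl, _root_.one_mul]
    rw [bar_apply, mul_apply (p₁ := 1), add_comm (splitSum _ _)]
    cases hc with
    | @here _ s _ c h' =>
      obtain rfl : s = t + 1 := by omega
      rw [tau_mul_snoc, barSum_snoc_id c h' rfl _ (hm _ _ _ _ _) (h _ _ _ _ _) _ h₁ h₃ h₄]
      obtain rfl : p + (t + 1) = q := by omega
      rw [G.map_id, E.id_comp, zero_sub, mul_neg, _root_.mul_one, sgn_neg]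
    | snoc g h' hc =>
      rw [tau_mul_snoc, barSum_snoc_hasId hc g h' rfl _ (hm _ _ _ _ _) (h _ _ _ _ _) _ h₁ h₃ h₄,
        h _ _ _ _ _ _ hc, map_zero, smul_zero, smul_zero]
  rw [RawCoch.hoch, sub_apply, sub_apply, smul_apply, smul_apply, key, smul_add]
  abel

end

end RawCoch

/-! ### The dg category of coherent natural transformations -/

/-- The coherent natural transformations `F ⟹ G` of degree `p`: the cochains of total degree `p`
(one component for each length `n` of the chains) that are `k`-linear in each morphism of the chain
and vanish on chains that contain an identity (the normalised Hochschild cochains of `D` with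
coefficients in the bimodule `E (F -) (G -)`). -/
def CohHom {D E : DGCat k} (F G : DGFunctor D E) (p : ℤ) :
    Submodule k (RawCoch D.toGrCat E.toGrCat F.obj G.obj p) where
  carrier := {Ψ | Ψ.IsMultiLin ∧ Ψ.IsNormal}
  add_mem' h h' := ⟨h.1.add h'.1, fun y₀ y₁ t q hq c hc => by
    rw [RawCoch.add_apply, h.2 _ _ _ _ _ _ hc, h'.2 _ _ _ _ _ _ hc, add_zero]⟩
  zero_mem' := ⟨fun y₀ y₁ t q hq x c c₁ c₂ hc => by simp [RawCoch.zero_apply],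
    fun y₀ y₁ t q hq c hc => rfl⟩
  smul_mem' x _ h := ⟨h.1.smul x, fun y₀ y₁ t q hq c hc => by
    rw [RawCoch.smul_apply, h.2 _ _ _ _ _ _ hc, smul_zero]⟩

/-- The differential of a cochain `Ψ` of degree `p`:
`d_E ∘ Ψ + τ_G * Ψ - (-1) ^ p • Ψ * τ_F - (-1) ^ p • Ψ ∘ b`. -/
def cohD {D E : DGCat k} (F G : DGFunctor D E) {p p' : ℤ} (h : p + 1 = p')
    (Ψ : RawCoch D.toGrCat E.toGrCat F.obj G.obj p) :
    RawCoch D.toGrCat E.toGrCat F.obj G.obj p' :=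
  RawCoch.post E.der h Ψ + RawCoch.hoch F.toGrFunctor G.toGrFunctor h Ψ

theorem cohD_cohD {D E : DGCat k} (F G : DGFunctor D E) {p p' p'' : ℤ} (h : p + 1 = p')
    (h' : p' + 1 = p'') (Ψ : RawCoch D.toGrCat E.toGrCat F.obj G.obj p) (hΨ : Ψ.IsMultiLin) :
    cohD F G h' (cohD F G h Ψ) = 0 := by
  have e₁ : RawCoch.post E.der h' (RawCoch.post E.der h Ψ) = 0 := by
    subst h h'
    funext y₀ y₁ t q hq c
    rw [RawCoch.post_apply, RawCoch.post_apply]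
    exact E.d_d _ _ _
  have hF := RawCoch.maurerCartan E.der F.toGrFunctor F.map_d
  have hG := RawCoch.maurerCartan E.der G.toGrFunctor G.map_d
  have e₂ := RawCoch.hoch_hoch (F := F.toGrFunctor) (G := G.toGrFunctor) h h' Ψ hΨ
  have e₃ := RawCoch.post_hoch (F := F.toGrFunctor) (G := G.toGrFunctor) E.der h h' Ψ
  have e₄ := RawCoch.add_mul (p₁ := p) (p := p'') (by omega)
    (RawCoch.bar (p' := 2) rfl (RawCoch.tau G.toGrFunctor) + RawCoch.mul (p := 2) rfl
      (RawCoch.tau G.toGrFunctor) (RawCoch.tau G.toGrFunctor))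
    (RawCoch.post E.der (p' := 2) rfl (RawCoch.tau G.toGrFunctor)) Ψ
  have e₅ := RawCoch.mul_add (p₂ := p) (p := p'') (by omega) Ψ
    (RawCoch.bar (p' := 2) rfl (RawCoch.tau F.toGrFunctor) + RawCoch.mul (p := 2) rfl
      (RawCoch.tau F.toGrFunctor) (RawCoch.tau F.toGrFunctor))
    (RawCoch.post E.der (p' := 2) rfl (RawCoch.tau F.toGrFunctor))
  rw [hG, RawCoch.zero_mul] at e₄
  rw [hF, RawCoch.mul_zero] at e₅
  unfold cohD
  rw [RawCoch.post_add, RawCoch.hoch_add, e₁, e₂, e₃, eq_neg_of_add_eq_zero_left e₄.symm,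
    eq_neg_of_add_eq_zero_left e₅.symm]
  abel

/-- The composition of coherent natural transformations. -/
def cohComp {D E : DGCat k} {F G H : DGFunctor D E} {m n p : ℤ} (h : m + n = p) :
    CohHom G H m →ₗ[k] CohHom F G n →ₗ[k] CohHom F H p :=
  LinearMap.mk₂ k
    (fun Ψ₂ Ψ₁ => ⟨RawCoch.mul h Ψ₂.1 Ψ₁.1, Ψ₂.2.1.mul Ψ₁.2.1, Ψ₂.2.2.mul Ψ₁.2.2⟩)
    (fun _ _ _ => Subtype.ext (RawCoch.add_mul h _ _ _))
    (fun _ _ _ => Subtype.ext (RawCoch.smul_mul h _ _ _))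
    (fun _ _ _ => Subtype.ext (RawCoch.mul_add h _ _ _))
    (fun _ _ _ => Subtype.ext (RawCoch.mul_smul h _ _ _))

/-- The differential of coherent natural transformations. -/
def cohDiff {D E : DGCat k} {F G : DGFunctor D E} {p p' : ℤ} (h : p + 1 = p') :
    CohHom F G p →ₗ[k] CohHom F G p' where
  toFun Ψ := ⟨cohD F G h Ψ.1, Ψ.2.1.post.add Ψ.2.1.hoch, fun y₀ y₁ t q hq c hc => by
    rw [cohD, RawCoch.add_apply, Ψ.2.2.post _ _ _ _ _ _ hc,
      Ψ.2.2.hoch Ψ.2.1 _ _ _ _ _ _ hc, add_zero]⟩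
  map_add' Ψ Ψ' := Subtype.ext (by
    change cohD F G h (Ψ.1 + Ψ'.1) = cohD F G h Ψ.1 + cohD F G h Ψ'.1
    rw [cohD, RawCoch.post_add, RawCoch.hoch_add, add_add_add_comm]; rfl)
  map_smul' x Ψ := Subtype.ext (by
    change cohD F G h (x • Ψ.1) = x • cohD F G h Ψ.1
    rw [cohD, RawCoch.post_smul, RawCoch.hoch_smul, ← smul_add]; rfl)

/-- The dg category of dg functors `D ⥤ E` and coherent natural transformations. The composition is
`RawCoch.mul` and the differential is `cohD`. -/
def DGCat.Coh (D E : DGCat k) : DGCat k where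
  Obj := DGFunctor D E
  Hom F G p := CohHom F G p
  id F := ⟨RawCoch.one F.obj, RawCoch.IsMultiLin.one _, RawCoch.IsNormal.one _⟩
  comp h := cohComp h
  id_comp Ψ := Subtype.ext (RawCoch.one_mul (zero_add _) Ψ.1)
  comp_id Ψ := Subtype.ext (RawCoch.mul_one (add_zero _) Ψ.1)
  assoc h₁ h₂ h₃ h₄ Ψ₃ Ψ₂ Ψ₁ := Subtype.ext (RawCoch.mul_assoc h₁ h₂ h₃ h₄ Ψ₃.1 Ψ₂.1 Ψ₁.1)
  d h := cohDiff h
  d_d h h' Ψ := Subtype.ext (cohD_cohD _ _ h h' Ψ.1 Ψ.2.1)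
  leibniz {F G H m n p m' n' p'} h hm hn hp Ψ₂ Ψ₁ := Subtype.ext (by
    change cohD F H hp (RawCoch.mul h Ψ₂.1 Ψ₁.1) =
      RawCoch.mul (by omega) (cohD G H hm Ψ₂.1) Ψ₁.1 +
        sgn k m • RawCoch.mul (by omega) Ψ₂.1 (cohD F G hn Ψ₁.1)
    unfold cohD
    rw [RawCoch.post_mul E.der h hp hn hm, RawCoch.hoch_mul h hp hn hm, RawCoch.add_mul,
      RawCoch.mul_add, smul_add, add_add_add_comm])

/-! ### Functoriality of the coherent natural transformations -/

namespace Chain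

/-- The image of a chain under a functor. -/
def map {D D' : GrCat k} (b : GrFunctor D' D) : ∀ {y₀ y : D'.Obj} {t : ℤ},
    Chain D' y₀ y t → Chain D (b.obj y₀) (b.obj y) t
  | _, _, _, nil _ => nil _
  | _, _, _, snoc c g h => snoc (c.map b) (b.map g) h

theorem LinComb.map {D D' : GrCat k} (b : GrFunctor D' D) {r : k} {y₀ y : D'.Obj} {t : ℤ}
    {c c₁ c₂ : Chain D' y₀ y t} (hc : LinComb r c c₁ c₂) :
    LinComb r (c.map b) (c₁.map b) (c₂.map b) := by
  induction hc with
  | here c g₁ g₂ h =>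
    simp only [Chain.map, map_add, map_smul]
    exact LinComb.here _ _ _ _
  | snoc g h hc ih =>
    simp only [Chain.map]
    exact LinComb.snoc _ _ ih

theorem HasId.map {D D' : GrCat k} (b : GrFunctor D' D) {y₀ y : D'.Obj} {t : ℤ}
    {c : Chain D' y₀ y t} (hc : HasId c) : HasId (c.map b) := by
  induction hc with
  | here c h =>
    simp only [Chain.map, b.map_id]
    exact HasId.here _ _
  | snoc g h hc ih =>
    simp only [Chain.map]
    exact HasId.snoc _ _ ih

theorem Pos.map {D D' : GrCat k} (b : GrFunctor D' D) {y₀ y : D'.Obj} {t : ℤ}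
    {c : Chain D' y₀ y t} (hc : Pos c) : Pos (c.map b) := by
  cases hc
  simp only [Chain.map]
  exact Pos.snoc _ _ _

theorem splitSum_chainMap {D D' : GrCat k} (b : GrFunctor D' D) {M : Type u} [Add M]
    {y₀ y₁ : D'.Obj} {t : ℤ} (c : Chain D' y₀ y₁ t)
    (Φ : ∀ (y : D.Obj) (s r : ℤ), s + r = t → Chain D (b.obj y₀) y s → Chain D y (b.obj y₁) r → M) :
    (c.map b).splitSum Φ = c.splitSum fun y s r h c₁ c₂ => Φ (b.obj y) s r h (c₁.map b) (c₂.map b) := by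
  induction c with
  | nil => simp only [Chain.map, splitSum]
  | snoc c g h ih => simp only [Chain.map, splitSum, ih]

theorem lastComp_chainMap {D D' : GrCat k} (b : GrFunctor D' D) {M : Type u} [AddCommGroup M]
    [Module k M] {y₀ y y' : D'.Obj} {s a t : ℤ} (c : Chain D' y₀ y s) (g : D'.Hom y y' a)
    (h : s + a = t) (Φ : Chain D (b.obj y₀) (b.obj y') t → M) :
    (c.map b).lastComp (b.map g) h Φ = c.lastComp g h fun c => Φ (c.map b) := by
  cases c with
  | nil => simp only [Chain.map, lastComp_nil]
  | snoc c g' h' => simp only [Chain.map, lastComp_snoc, b.map_comp]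

theorem barSum_chainMap {D D' : DGCat k} (b : DGFunctor D' D) {M : Type u} [AddCommGroup M]
    [Module k M] {y₀ y : D'.Obj} {t t' : ℤ} (c : Chain D'.toGrCat y₀ y t) (h : t + 1 = t')
    (Φ : Chain D.toGrCat (b.obj y₀) (b.obj y) t' → M) :
    (c.map b.toGrFunctor).barSum h Φ = c.barSum h fun c => Φ (c.map b.toGrFunctor) := by
  induction c generalizing t' with
  | nil => simp only [Chain.map, barSum]
  | snoc c g h ih =>
    simp only [Chain.map, barSum, lastComp_chainMap, ih, b.map_d]

end Chain

namespace RawCoch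

section

variable {D D' E E' : GrCat k} {F G H : D.Obj → E.Obj} {p₁ p₂ p : ℤ}

/-- The cochain `h ∘ Ψ ∘ b`, for functors `b` into the source and `h` out of the target. -/
def map (b : GrFunctor D' D) (h : GrFunctor E E') (Ψ : RawCoch D E F G p) :
    RawCoch D' E' (fun y => h.obj (F (b.obj y))) (fun y => h.obj (G (b.obj y))) p :=
  fun _ _ _ _ hq c => h.map (Ψ _ _ _ _ hq (c.map b))

theorem map_mul (b : GrFunctor D' D) (h : GrFunctor E E') (hp : p₂ + p₁ = p)
    (Ψ₂ : RawCoch D E G H p₂) (Ψ₁ : RawCoch D E F G p₁) :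
    map b h (mul hp Ψ₂ Ψ₁) = mul hp (map b h Ψ₂) (map b h Ψ₁) := by
  funext y₀ y₁ t q hq c
  simp only [map, mul, splitSum_chainMap]
  rw [splitSum_map _ (map_add _)]
  simp only [map_smul, h.map_comp]

theorem map_one (b : GrFunctor D' D) (h : GrFunctor E E') :
    map b h (one F) = one fun y => h.obj (F (b.obj y)) := by
  funext y₀ y₁ t q hq c
  cases c with
  | nil => simp only [map, one, Chain.map, h.map_cast, h.map_id]
  | snoc c g h' => simp only [map, one, Chain.map, map_zero]

theorem map_tau (b : GrFunctor D' D) (h : GrFunctor E E') (F : GrFunctor D E) :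
    map b h (tau F) = tau (b.comp (F.comp h)) := by
  funext y₀ y₁ t q hq c
  cases c with
  | nil => simp only [map, tau, Chain.map, map_zero]; rfl
  | snoc c g h' =>
    cases c with
    | nil => simp only [map, tau, Chain.map, h.map_cast]; rfl
    | snoc c g' h'' => simp only [map, tau, Chain.map, map_zero]; rfl

theorem map_add' (b : GrFunctor D' D) (h : GrFunctor E E') (Ψ Ψ' : RawCoch D E F G p) :
    map b h (Ψ + Ψ') = map b h Ψ + map b h Ψ' := by
  funext y₀ y₁ t q hq c
  exact map_add _ _ _

theorem map_smul' (b : GrFunctor D' D) (h : GrFunctor E E') (x : k) (Ψ : RawCoch D E F G p) :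
    map b h (x • Ψ) = x • map b h Ψ := by
  funext y₀ y₁ t q hq c
  exact map_smul _ _ _

theorem map_sub' (b : GrFunctor D' D) (h : GrFunctor E E') (Ψ Ψ' : RawCoch D E F G p) :
    map b h (Ψ - Ψ') = map b h Ψ - map b h Ψ' := by
  have := map_add' b h Ψ (-1 • Ψ')
  rw [neg_smul, _root_.one_smul, ← sub_eq_add_neg] at this
  rw [this, sub_eq_add_neg]
  congr 1
  funext y₀ y₁ t q hq c
  exact map_neg _ _

theorem IsMultiLin.map {b : GrFunctor D' D} {h : GrFunctor E E'} {Ψ : RawCoch D E F G p}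
    (hΨ : Ψ.IsMultiLin) : (map b h Ψ).IsMultiLin := by
  intro y₀ y₁ t q hq r c c₁ c₂ hc
  simp only [RawCoch.map, hΨ _ _ _ _ _ r _ _ _ (hc.map b), _root_.map_add, _root_.map_smul]

theorem IsNormal.map {b : GrFunctor D' D} {h : GrFunctor E E'} {Ψ : RawCoch D E F G p}
    (hΨ : Ψ.IsNormal) : (map b h Ψ).IsNormal := by
  intro y₀ y₁ t q hq c hc
  simp only [RawCoch.map, hΨ _ _ _ _ _ _ (hc.map b), map_zero]

end

section

variable {D D' : DGCat k} {E E' : GrCat k} {p p' : ℤ}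

theorem map_bar {F G : D.Obj → E.Obj} (b : DGFunctor D' D) (h : GrFunctor E E') (hp : p + 1 = p')
    (Ψ : RawCoch D.toGrCat E F G p) :
    map b.toGrFunctor h (bar hp Ψ) = bar hp (map b.toGrFunctor h Ψ) := by
  funext y₀ y₁ t q hq c
  simp only [map, bar, barSum_chainMap]
  exact barSum_map _ _ _ _

theorem map_hoch {F G : GrFunctor D.toGrCat E} (b : DGFunctor D' D) (h : GrFunctor E E')
    (hp : p + 1 = p') (Ψ : RawCoch D.toGrCat E F.obj G.obj p) :
    map b.toGrFunctor h (hoch F G hp Ψ) =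
      hoch (b.toGrFunctor.comp (F.comp h)) (b.toGrFunctor.comp (G.comp h)) hp (map b.toGrFunctor h Ψ) := by
  simp only [hoch, map_sub', map_smul', map_bar, map_mul, map_tau]
  rfl

theorem map_post {F G : D.Obj → E.Obj} (δ : GrDer E) (δ' : GrDer E') (b : DGFunctor D' D)
    (h : GrFunctor E E')
    (hδ : ∀ {X Y : E.Obj} {m n : ℤ} (e : m + 1 = n) (f : E.Hom X Y m),
      h.map (δ.d e f) = δ'.d e (h.map f)) (hp : p + 1 = p') (Ψ : RawCoch D.toGrCat E F G p) :
    map b.toGrFunctor h (post δ hp Ψ) = post δ' hp (map b.toGrFunctor h Ψ) := by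
  funext y₀ y₁ t q hq c
  simp only [map, post, hδ]

end

end RawCoch

/-- The map `Ψ ↦ h ∘ Ψ ∘ b` on coherent natural transformations. -/
def cohMap {D D' E E' : DGCat k} (b : DGFunctor D' D) (h : DGFunctor E E') {F G : DGFunctor D E}
    {p : ℤ} : CohHom F G p →ₗ[k] CohHom (b.comp (F.comp h)) (b.comp (G.comp h)) p where
  toFun Ψ := ⟨RawCoch.map b.toGrFunctor h.toGrFunctor Ψ.1, Ψ.2.1.map, Ψ.2.2.map⟩
  map_add' Ψ Ψ' := Subtype.ext (RawCoch.map_add' _ _ Ψ.1 Ψ'.1)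
  map_smul' x Ψ := Subtype.ext (RawCoch.map_smul' _ _ x Ψ.1)

/-- Functoriality of coherent natural transformations: the dg functor
`Coh D E ⥤ Coh D' E'`, `F ↦ h ∘ F ∘ b`, `Ψ ↦ h ∘ Ψ ∘ b`. -/
def DGCat.Coh.map {D D' E E' : DGCat k} (b : DGFunctor D' D) (h : DGFunctor E E') :
    DGFunctor (D.Coh E) (D'.Coh E') where
  obj (F : DGFunctor D E) := b.comp (F.comp h)
  map := cohMap b h
  map_id F := Subtype.ext (RawCoch.map_one (F := F.obj) _ _)
  map_comp e Ψ₂ Ψ₁ := Subtype.ext (RawCoch.map_mul _ _ e Ψ₂.1 Ψ₁.1)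
  map_d {F G m n} e Ψ := Subtype.ext (by
    change RawCoch.map _ _ (cohD F G e Ψ.1) = cohD (b.comp (F.comp h)) (b.comp (G.comp h)) e
      (RawCoch.map b.toGrFunctor h.toGrFunctor Ψ.1)
    unfold cohD
    rw [RawCoch.map_add', RawCoch.map_post E.der E'.der b _ h.map_d, RawCoch.map_hoch]
    rfl)

/-! ### The twisted tensor product -/

/-- Formal expressions for the morphisms of the twisted tensor product, of a given degree. The
expression `eps f c h` stands for `ε(f; g₁, …, gₙ)`, of degree `|f| + ∑ (|g_i| - 1)`, where
`c = (g₁, …, gₙ)`; for the empty chain `c = nil e` it stands for `f ⊗ id_e`.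
The expression `right c g` stands for `id_c ⊗ g`. -/
inductive Pre (C D : GrCat k) : C.Obj × D.Obj → C.Obj × D.Obj → ℤ → Type u
  | zero {X Y : C.Obj × D.Obj} {m : ℤ} : Pre C D X Y m
  | add {X Y : C.Obj × D.Obj} {m : ℤ} (x y : Pre C D X Y m) : Pre C D X Y m
  | smul {X Y : C.Obj × D.Obj} {m : ℤ} (r : k) (x : Pre C D X Y m) : Pre C D X Y m
  | id (X : C.Obj × D.Obj) : Pre C D X X 0
  | comp {X Y Z : C.Obj × D.Obj} {m n p : ℤ} (h : m + n = p) (x : Pre C D Y Z m)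
      (y : Pre C D X Y n) : Pre C D X Z p
  | eps {c c' : C.Obj} {e e' : D.Obj} {a t m : ℤ} (f : C.Hom c c' a) (g : Chain D e e' t)
      (h : a + t = m) : Pre C D (c, e) (c', e') m
  | right (c : C.Obj) {e e' : D.Obj} {m : ℤ} (g : D.Hom e e' m) : Pre C D (c, e) (c, e') m

instance {C D : GrCat k} (X Y : C.Obj × D.Obj) (m : ℤ) : Add (Pre C D X Y m) := ⟨Pre.add⟩

namespace Pre

variable {C D : GrCat k}

/-- The defining relations of the twisted tensor product. -/
inductive Rel : ∀ {X Y : C.Obj × D.Obj} {m : ℤ}, Pre C D X Y m → Pre C D X Y m → Prop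
  /- The relations are compatible with all operations. -/
  | add_congr_left {X Y : C.Obj × D.Obj} {m : ℤ} {x x' : Pre C D X Y m} (y : Pre C D X Y m)
      (h : Rel x x') : Rel (x.add y) (x'.add y)
  | add_congr_right {X Y : C.Obj × D.Obj} {m : ℤ} (x : Pre C D X Y m) {y y' : Pre C D X Y m}
      (h : Rel y y') : Rel (x.add y) (x.add y')
  | smul_congr {X Y : C.Obj × D.Obj} {m : ℤ} {x x' : Pre C D X Y m} (r : k)
      (h : Rel x x') : Rel (x.smul r) (x'.smul r)
  | comp_congr_left {X Y Z : C.Obj × D.Obj} {m n p : ℤ} (h : m + n = p) {x x' : Pre C D Y Z m}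
      (y : Pre C D X Y n) (hx : Rel x x') : Rel (comp h x y) (comp h x' y)
  | comp_congr_right {X Y Z : C.Obj × D.Obj} {m n p : ℤ} (h : m + n = p) (x : Pre C D Y Z m)
      {y y' : Pre C D X Y n} (hy : Rel y y') : Rel (comp h x y) (comp h x y')
  /- The morphisms of a given degree form a `k`-module. -/
  | add_comm {X Y : C.Obj × D.Obj} {m : ℤ} (x y : Pre C D X Y m) : Rel (x.add y) (y.add x)
  | add_assoc {X Y : C.Obj × D.Obj} {m : ℤ} (x y z : Pre C D X Y m) :
      Rel ((x.add y).add z) (x.add (y.add z))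
  | zero_add {X Y : C.Obj × D.Obj} {m : ℤ} (x : Pre C D X Y m) : Rel (zero.add x) x
  | one_smul {X Y : C.Obj × D.Obj} {m : ℤ} (x : Pre C D X Y m) : Rel (x.smul 1) x
  | mul_smul {X Y : C.Obj × D.Obj} {m : ℤ} (r s : k) (x : Pre C D X Y m) :
      Rel (x.smul (r * s)) ((x.smul s).smul r)
  | smul_add {X Y : C.Obj × D.Obj} {m : ℤ} (r : k) (x y : Pre C D X Y m) :
      Rel ((x.add y).smul r) ((x.smul r).add (y.smul r))
  | add_smul {X Y : C.Obj × D.Obj} {m : ℤ} (r s : k) (x : Pre C D X Y m) :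
      Rel (x.smul (r + s)) ((x.smul r).add (x.smul s))
  | zero_smul {X Y : C.Obj × D.Obj} {m : ℤ} (x : Pre C D X Y m) : Rel (x.smul 0) zero
  /- The composition is bilinear, unital and associative. -/
  | comp_add {X Y Z : C.Obj × D.Obj} {m n p : ℤ} (h : m + n = p) (x : Pre C D Y Z m)
      (y y' : Pre C D X Y n) : Rel (comp h x (y.add y')) ((comp h x y).add (comp h x y'))
  | comp_smul {X Y Z : C.Obj × D.Obj} {m n p : ℤ} (h : m + n = p) (x : Pre C D Y Z m) (r : k)
      (y : Pre C D X Y n) : Rel (comp h x (y.smul r)) ((comp h x y).smul r)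
  | add_comp {X Y Z : C.Obj × D.Obj} {m n p : ℤ} (h : m + n = p) (x x' : Pre C D Y Z m)
      (y : Pre C D X Y n) : Rel (comp h (x.add x') y) ((comp h x y).add (comp h x' y))
  | smul_comp {X Y Z : C.Obj × D.Obj} {m n p : ℤ} (h : m + n = p) (r : k) (x : Pre C D Y Z m)
      (y : Pre C D X Y n) : Rel (comp h (x.smul r) y) ((comp h x y).smul r)
  | id_comp {X Y : C.Obj × D.Obj} {m : ℤ} (h : 0 + m = m) (x : Pre C D X Y m) :
      Rel (comp h (id Y) x) x
  | comp_id {X Y : C.Obj × D.Obj} {m : ℤ} (h : m + 0 = m) (x : Pre C D X Y m) :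
      Rel (comp h x (id X)) x
  | assoc {X Y Z W : C.Obj × D.Obj} {a b c ab bc abc : ℤ} (h₁ : a + b = ab) (h₂ : ab + c = abc)
      (h₃ : b + c = bc) (h₄ : a + bc = abc) (x : Pre C D Z W a) (y : Pre C D Y Z b)
      (z : Pre C D X Y c) : Rel (comp h₂ (comp h₁ x y) z) (comp h₄ x (comp h₃ y z))
  /- `g ↦ id_c ⊗ g` is a functor, and `id_c ⊗ id_e` (in either factor) is the identity
  of `(c, e)`. The composition law for `f ⊗ id_e` is `eps_comp` for the empty chain. -/
  | right_add (c : C.Obj) {e e' : D.Obj} {m : ℤ} (g g' : D.Hom e e' m) :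
      Rel (right c (g + g')) ((right c g).add (right c g'))
  | right_smul (c : C.Obj) {e e' : D.Obj} {m : ℤ} (r : k) (g : D.Hom e e' m) :
      Rel (right c (r • g)) ((right c g).smul r)
  | right_id (c : C.Obj) (e : D.Obj) : Rel (right c (D.id e)) (id (c, e))
  | right_comp (c : C.Obj) {e e' e'' : D.Obj} {m n p : ℤ} (h : m + n = p) (g : D.Hom e' e'' m)
      (g' : D.Hom e e' n) : Rel (right c (D.comp h g g')) (comp h (right c g) (right c g'))
  | eps_id (c : C.Obj) (e : D.Obj) (h : (0 : ℤ) + 0 = 0) :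
      Rel (eps (C.id c) (Chain.nil e) h) (id (c, e))
  /- `ε(f; g₁, …, gₙ)` is linear in each argument. -/
  | eps_add {c c' : C.Obj} {e e' : D.Obj} {a t m : ℤ} (f f' : C.Hom c c' a) (g : Chain D e e' t)
      (h : a + t = m) : Rel (eps (f + f') g h) ((eps f g h).add (eps f' g h))
  | eps_smul {c c' : C.Obj} {e e' : D.Obj} {a t m : ℤ} (r : k) (f : C.Hom c c' a)
      (g : Chain D e e' t) (h : a + t = m) : Rel (eps (r • f) g h) ((eps f g h).smul r)
  | eps_lin {c c' : C.Obj} {e e' : D.Obj} {a t m : ℤ} (f : C.Hom c c' a) (r : k)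
      {g g₁ g₂ : Chain D e e' t} (hg : Chain.LinComb r g g₁ g₂) (h : a + t = m) :
      Rel (eps f g h) (((eps f g₁ h).smul r).add (eps f g₂ h))
  /- `ε(f; g₁, …, gₙ) = 0` for `n ≥ 1` if `f` or one of the `g_i` is an identity. -/
  | eps_hasId {c c' : C.Obj} {e e' : D.Obj} {a t m : ℤ} (f : C.Hom c c' a) {g : Chain D e e' t}
      (hg : g.HasId) (h : a + t = m) : Rel (eps f g h) zero
  | eps_id_pos (c : C.Obj) {e e' : D.Obj} {t m : ℤ} {g : Chain D e e' t} (hg : g.Pos)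
      (h : 0 + t = m) : Rel (eps (C.id c) g h) zero
  /- `ε(f₂ ∘ f₁; g₁, …, gₙ) = ∑_m (-1) ^ (|f₁| * ∑_{i > m} (|g_i| - 1)) •
    ε(f₂; g_{m+1}, …, gₙ) ∘ ε(f₁; g₁, …, g_m)`. -/
  | eps_comp {c c' c'' : C.Obj} {e e' : D.Obj} {a₁ a₂ a t m : ℤ} (ha : a₂ + a₁ = a)
      (f₂ : C.Hom c' c'' a₂) (f₁ : C.Hom c c' a₁) (g : Chain D e e' t) (h : a + t = m) :
      Rel (eps (C.comp ha f₂ f₁) g h)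
        (g.splitSum fun _ s r hsr g₁ g₂ => smul (sgn k (a₁ * r))
          (comp (m := a₂ + r) (n := a₁ + s) (by omega) (eps f₂ g₂ rfl) (eps f₁ g₁ rfl)))

/-- The morphisms of degree `m` in the twisted tensor product. -/
def Hom (C D : GrCat k) (X Y : C.Obj × D.Obj) (m : ℤ) : Type u :=
  Quot (Rel (C := C) (D := D) (X := X) (Y := Y) (m := m))

namespace Hom

variable {X Y Z W : C.Obj × D.Obj} {m n p : ℤ}

instance : Zero (Hom C D X Y m) := ⟨Quot.mk _ zero⟩

instance : Add (Hom C D X Y m) :=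
  ⟨Quot.map₂ add (fun x _ _ h => Rel.add_congr_right x h) (fun _ _ y h => Rel.add_congr_left y h)⟩

instance : SMul k (Hom C D X Y m) :=
  ⟨fun r => Quot.map (smul r) fun _ _ h => Rel.smul_congr r h⟩

protected theorem add_comm (x y : Hom C D X Y m) : x + y = y + x := by
  induction x using Quot.ind; induction y using Quot.ind
  exact Quot.sound (Rel.add_comm _ _)

protected theorem add_assoc (x y z : Hom C D X Y m) : x + y + z = x + (y + z) := by
  induction x using Quot.ind; induction y using Quot.ind; induction z using Quot.ind
  exact Quot.sound (Rel.add_assoc _ _ _)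

protected theorem zero_add (x : Hom C D X Y m) : 0 + x = x := by
  induction x using Quot.ind
  exact Quot.sound (Rel.zero_add _)

protected theorem one_smul (x : Hom C D X Y m) : (1 : k) • x = x := by
  induction x using Quot.ind
  exact Quot.sound (Rel.one_smul _)

protected theorem mul_smul (r s : k) (x : Hom C D X Y m) : (r * s) • x = r • s • x := by
  induction x using Quot.ind
  exact Quot.sound (Rel.mul_smul _ _ _)

protected theorem smul_add (r : k) (x y : Hom C D X Y m) : r • (x + y) = r • x + r • y := by
  induction x using Quot.ind; induction y using Quot.ind
  exact Quot.sound (Rel.smul_add _ _ _)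

protected theorem add_smul (r s : k) (x : Hom C D X Y m) : (r + s) • x = r • x + s • x := by
  induction x using Quot.ind
  exact Quot.sound (Rel.add_smul _ _ _)

protected theorem zero_smul (x : Hom C D X Y m) : (0 : k) • x = 0 := by
  induction x using Quot.ind
  exact Quot.sound (Rel.zero_smul _)

instance : Neg (Hom C D X Y m) := ⟨fun x => (-1 : k) • x⟩

instance : AddCommGroup (Hom C D X Y m) where
  nsmul := nsmulRec
  zsmul := zsmulRec
  add_assoc := Hom.add_assoc
  zero_add := Hom.zero_add
  add_zero x := by rw [Hom.add_comm, Hom.zero_add]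
  add_comm := Hom.add_comm
  neg_add_cancel x := by
    change (-1 : k) • x + x = 0
    conv_lhs => rw [← Hom.one_smul x, ← Hom.mul_smul, ← Hom.add_smul]
    rw [mul_one, neg_add_cancel, Hom.zero_smul]

instance : Module k (Hom C D X Y m) where
  one_smul := Hom.one_smul
  mul_smul := Hom.mul_smul
  smul_add := Hom.smul_add
  add_smul := Hom.add_smul
  zero_smul := Hom.zero_smul
  smul_zero r := by
    rw [← Hom.zero_smul (0 : Hom C D X Y m), ← Hom.mul_smul, mul_zero]

/-- The composition in the twisted tensor product. -/
def compHom (h : m + n = p) : Hom C D Y Z m →ₗ[k] Hom C D X Y n →ₗ[k] Hom C D X Z p :=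
  LinearMap.mk₂ k
    (Quot.map₂ (Pre.comp h) (fun x _ _ hy => Rel.comp_congr_right h x hy)
      (fun _ _ y hx => Rel.comp_congr_left h y hx))
    (fun x x' y => by
      induction x using Quot.ind; induction x' using Quot.ind; induction y using Quot.ind
      exact Quot.sound (Rel.add_comp h _ _ _))
    (fun r x y => by
      induction x using Quot.ind; induction y using Quot.ind
      exact Quot.sound (Rel.smul_comp h _ _ _))
    (fun x y y' => by
      induction x using Quot.ind; induction y using Quot.ind; induction y' using Quot.ind
      exact Quot.sound (Rel.comp_add h _ _ _))
    (fun r x y => by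
      induction x using Quot.ind; induction y using Quot.ind
      exact Quot.sound (Rel.comp_smul h _ _ _))

end Hom

end Pre

/-- The graded category underlying the twisted tensor product. -/
abbrev GrCat.twistedTensor (C D : GrCat k) : GrCat k where
  Obj := C.Obj × D.Obj
  Hom := Pre.Hom C D
  id X := Quot.mk _ (Pre.id X)
  comp h := Pre.Hom.compHom h
  id_comp x := by
    induction x using Quot.ind
    exact Quot.sound (Pre.Rel.id_comp _ _)
  comp_id x := by
    induction x using Quot.ind
    exact Quot.sound (Pre.Rel.comp_id _ _)
  assoc h₁ h₂ h₃ h₄ x y z := by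
    induction x using Quot.ind; induction y using Quot.ind; induction z using Quot.ind
    exact Quot.sound (Pre.Rel.assoc h₁ h₂ h₃ h₄ _ _ _)

namespace Pre

variable {C D : GrCat k}

/-- The class of a formal expression. -/
def mk {X Y : C.Obj × D.Obj} {m : ℤ} (x : Pre C D X Y m) : (C.twistedTensor D).Hom X Y m :=
  Quot.mk _ x

theorem mk_add {X Y : C.Obj × D.Obj} {m : ℤ} (x y : Pre C D X Y m) :
    mk (x.add y) = mk x + mk y := rfl

theorem mk_smul {X Y : C.Obj × D.Obj} {m : ℤ} (r : k) (x : Pre C D X Y m) :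
    mk (x.smul r) = r • mk x := rfl

theorem mk_comp {X Y Z : C.Obj × D.Obj} {m n p : ℤ} (h : m + n = p) (x : Pre C D Y Z m)
    (y : Pre C D X Y n) : mk (comp h x y) = (C.twistedTensor D).comp h (mk x) (mk y) := rfl

theorem mk_zero {X Y : C.Obj × D.Obj} {m : ℤ} : mk (zero : Pre C D X Y m) = 0 := rfl

theorem mk_id (X : C.Obj × D.Obj) : mk (id X) = (C.twistedTensor D).id X := rfl

theorem mk_eq {X Y : C.Obj × D.Obj} {m : ℤ} {x y : Pre C D X Y m} (h : Rel x y) :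
    mk x = mk y := Quot.sound h

/-- The functor `e ↦ (c, e)`, `g ↦ id_c ⊗ g`. -/
def inr (c : C.Obj) : GrFunctor D (C.twistedTensor D) where
  obj e := (c, e)
  map :=
    { toFun := fun g => mk (right c g)
      map_add' := fun g g' => mk_eq (Rel.right_add c g g')
      map_smul' := fun r g => mk_eq (Rel.right_smul c r g) }
  map_id e := mk_eq (Rel.right_id c e)
  map_comp h f g := mk_eq (Rel.right_comp c h f g)

theorem inr_map (c : C.Obj) {e e' : D.Obj} {m : ℤ} (g : D.Hom e e' m) :
    (inr (C := C) c).map g = mk (right c g) := rfl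

/-- The cochain `(g₁, …, gₙ) ↦ ε(f; g₁, …, gₙ)`. -/
def epsC {c c' : C.Obj} {a : ℤ} (f : C.Hom c c' a) :
    RawCoch D (C.twistedTensor D) (inr c).obj (inr c').obj a :=
  fun _ _ _ _ h g => mk (eps f g h)

theorem epsC_add {c c' : C.Obj} {a : ℤ} (f f' : C.Hom c c' a) :
    epsC (D := D) (f + f') = epsC f + epsC f' := by
  funext e e' t q h g
  exact mk_eq (Rel.eps_add f f' g h)

theorem epsC_smul {c c' : C.Obj} {a : ℤ} (r : k) (f : C.Hom c c' a) :
    epsC (D := D) (r • f) = r • epsC f := by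
  funext e e' t q h g
  exact mk_eq (Rel.eps_smul r f g h)

theorem epsC_isMultiLin {c c' : C.Obj} {a : ℤ} (f : C.Hom c c' a) :
    (epsC (D := D) f).IsMultiLin := by
  intro e e' t q h r g g₁ g₂ hg
  exact mk_eq (Rel.eps_lin f r hg h)

theorem epsC_isNormal {c c' : C.Obj} {a : ℤ} (f : C.Hom c c' a) :
    (epsC (D := D) f).IsNormal := by
  intro e e' t q h g hg
  exact mk_eq (Rel.eps_hasId f hg h)

theorem epsC_id (c : C.Obj) : epsC (D := D) (C.id c) = RawCoch.one (inr c).obj := by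
  funext e e' t q h g
  cases g with
  | nil =>
    obtain rfl : q = 0 := by omega
    exact mk_eq (Rel.eps_id c _ h)
  | snoc g g' h' => exact mk_eq (Rel.eps_id_pos c (Chain.Pos.snoc _ _ _) h)

theorem epsC_comp {c c' c'' : C.Obj} {a₁ a₂ a : ℤ} (ha : a₂ + a₁ = a)
    (f₂ : C.Hom c' c'' a₂) (f₁ : C.Hom c c' a₁) :
    epsC (D := D) (C.comp ha f₂ f₁) = RawCoch.mul ha (epsC f₂) (epsC f₁) := by
  funext e e' t q h g
  refine (mk_eq (Rel.eps_comp ha f₂ f₁ g h)).trans ?_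
  exact splitSum_map mk mk_add g _

end Pre

theorem GrCat.leibniz_assoc (E : GrCat k) {X Y Z W : E.Obj} {a b c ab bc abc ab' bc' abc' : ℤ}
    (h₁ : a + b = ab) (h₂ : ab + c = abc) (h₃ : b + c = bc) (h₄ : a + bc = abc)
    (ha : ab + 1 = ab') (hb : bc + 1 = bc') (hc : abc + 1 = abc')
    (x : E.Hom Z W a) (y : E.Hom Y Z b) (z : E.Hom X Y c) (x' : E.Hom Z W (a + 1))
    (y' : E.Hom Y Z (b + 1)) (z' : E.Hom X Y (c + 1)) :
    E.comp (p := abc') (by omega) (E.comp (p := ab') (by omega) x' y +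
        sgn k a • E.comp (by omega) x y') z + sgn k ab • E.comp (by omega) (E.comp h₁ x y) z' =
      E.comp (p := abc') (by omega) x' (E.comp h₃ y z) + sgn k a • E.comp (by omega) x
        (E.comp (p := bc') (by omega) y' z + sgn k b • E.comp (by omega) y z') := by
  subst h₁ h₃ ha hb
  rw [map_add, LinearMap.add_apply, map_smul, LinearMap.smul_apply, map_add, map_smul, smul_add,
    smul_smul, sgn_add, add_assoc]
  congr 1
  · exact E.assoc _ _ _ _ _ _ _
  congr 2
  · exact E.assoc _ _ _ _ _ _ _
  · exact E.assoc _ _ _ _ _ _ _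

namespace Pre

variable {C D : DGCat k}

/-- The differential of `ε(f; g₁, …, gₙ)`, as a cochain in `(g₁, …, gₙ)`. With `ε f` for the cochain
`(g₁, …, gₙ) ↦ ε(f; g₁, …, gₙ)` of degree `|f|`, it is
`ε (d f) - (τ * ε f - (-1) ^ |f| • ε f * τ - (-1) ^ |f| • ε f ∘ b)`, where `τ` is the twisting
cochain of `g ↦ id_c ⊗ g` and `b` the bar differential. -/
def epsD {c c' : C.Obj} {a : ℤ} (f : C.Hom c c' a) :
    RawCoch D.toGrCat (C.toGrCat.twistedTensor D.toGrCat) (inr c).obj (inr c').obj (a + 1) :=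
  epsC (C.d rfl f) - RawCoch.hoch (inr c) (inr c') rfl (epsC f)

/-- The differential on formal expressions. -/
def dPre : ∀ {X Y : C.Obj × D.Obj} {m n : ℤ}, m + 1 = n → Pre C.toGrCat D.toGrCat X Y m →
    (C.toGrCat.twistedTensor D.toGrCat).Hom X Y n
  | _, _, _, _, _, zero => 0
  | _, _, _, _, h, add x y => dPre h x + dPre h y
  | _, _, _, _, h, smul r x => r • dPre h x
  | _, _, _, _, _, id _ => 0
  | _, _, _, _, _, @comp _ _ _ _ _ _ _ m _ _ h x y =>
      (C.toGrCat.twistedTensor D.toGrCat).comp (by omega) (dPre rfl x) (mk y) +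
        sgn k m • (C.toGrCat.twistedTensor D.toGrCat).comp (by omega) (mk x) (dPre rfl y)
  | _, _, _, _, _, eps f g h => epsD f _ _ _ _ (by omega) g
  | _, _, _, _, h, right c g => mk (right c (D.d h g))

theorem epsC_zero {c c' : C.Obj} {a : ℤ} :
    epsC (D := D.toGrCat) (0 : C.Hom c c' a) = 0 := by
  have := epsC_smul (D := D.toGrCat) (0 : k) (0 : C.Hom c c' a)
  rwa [zero_smul, zero_smul] at this

theorem epsD_isMultiLin {c c' : C.Obj} {a : ℤ} (f : C.Hom c c' a) :
    (epsD (D := D) f).IsMultiLin :=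
  (epsC_isMultiLin _).sub (epsC_isMultiLin f).hoch

theorem epsD_id (c : C.Obj) : epsD (D := D) (C.id c) = 0 := by
  have h : C.d (n := 0 + 1) rfl (C.id c) = 0 := C.d_id_cast rfl rfl
  rw [epsD, epsC_id, h, epsC_zero, zero_sub, neg_eq_zero]
  exact RawCoch.hoch_one

theorem epsD_add {c c' : C.Obj} {a : ℤ} (f f' : C.Hom c c' a) :
    epsD (D := D) (f + f') = epsD f + epsD f' := by
  simp only [epsD, map_add, epsC_add, RawCoch.hoch_add]
  abel

theorem epsD_smul {c c' : C.Obj} {a : ℤ} (r : k) (f : C.Hom c c' a) :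
    epsD (D := D) (r • f) = r • epsD f := by
  simp only [epsD, map_smul, epsC_smul, RawCoch.hoch_smul, smul_sub]

theorem epsD_comp {c c' c'' : C.Obj} {a₁ a₂ a : ℤ} (ha : a₂ + a₁ = a)
    (f₂ : C.Hom c' c'' a₂) (f₁ : C.Hom c c' a₁) :
    epsD (D := D) (C.comp ha f₂ f₁) = RawCoch.mul (by omega) (epsD f₂) (epsC f₁) +
      sgn k a₂ • RawCoch.mul (by omega) (epsC f₂) (epsD f₁) := by
  simp only [epsD]
  rw [C.leibniz ha rfl rfl rfl, epsC_add, epsC_smul, epsC_comp, epsC_comp, epsC_comp,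
    RawCoch.hoch_mul ha rfl rfl rfl]
  simp only [sub_eq_add_neg, ← neg_one_smul k (RawCoch.hoch _ _ _ _), RawCoch.add_mul,
    RawCoch.mul_add, RawCoch.mul_smul, RawCoch.smul_mul]
  module

theorem dPre_rel {X Y : C.Obj × D.Obj} {m n : ℤ} (h : m + 1 = n)
    {x y : Pre C.toGrCat D.toGrCat X Y m} (hxy : Rel x y) : dPre h x = dPre h y := by
  induction hxy generalizing n with
  | add_congr_left y _ ih => simp only [dPre, ih]
  | add_congr_right x _ ih => simp only [dPre, ih]
  | smul_congr r _ ih => simp only [dPre, ih]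
  | comp_congr_left h y hx ih => simp only [dPre, ih, mk_eq hx]
  | comp_congr_right h y hx ih => simp only [dPre, ih, mk_eq hx]
  | add_comm x y => simp only [dPre]; exact _root_.add_comm _ _
  | add_assoc x y z => simp only [dPre]; exact _root_.add_assoc _ _ _
  | zero_add x => simp only [dPre]; exact _root_.zero_add _
  | one_smul x => simp only [dPre]; exact _root_.one_smul _ _
  | mul_smul r s x => simp only [dPre]; exact SemigroupAction.mul_smul _ _ _
  | smul_add r x y => simp only [dPre]; exact _root_.smul_add _ _ _
  | add_smul r s x => simp only [dPre]; exact _root_.add_smul _ _ _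
  | zero_smul x => simp only [dPre]; exact _root_.zero_smul _ _
  | comp_add h x y y' => simp only [dPre, mk_add, map_add, _root_.smul_add]; abel
  | comp_smul h x r y =>
    simp only [dPre, mk_smul, map_smul, _root_.smul_add, smul_comm r]
  | add_comp h x x' y =>
    simp only [dPre, mk_add, map_add, LinearMap.add_apply, _root_.smul_add]; abel
  | smul_comp h r x y =>
    simp only [dPre, mk_smul, map_smul, LinearMap.smul_apply, _root_.smul_add, smul_comm r]
  | id_comp h' x =>
    subst h
    simp only [dPre, map_zero, LinearMap.zero_apply, sgn_zero, _root_.one_smul, _root_.zero_add,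
      mk_id]
    exact (C.toGrCat.twistedTensor D.toGrCat).id_comp (dPre rfl x)
  | comp_id h' x =>
    subst h
    simp only [dPre, map_zero, smul_zero, _root_.add_zero, mk_id]
    exact (C.toGrCat.twistedTensor D.toGrCat).comp_id (dPre rfl x)
  | assoc h₁ h₂ h₃ h₄ x y z =>
    simp only [dPre, mk_comp]
    exact (C.toGrCat.twistedTensor D.toGrCat).leibniz_assoc h₁ h₂ h₃ h₄ rfl rfl h _ _ _ _ _ _
  | right_add c g g' => simp only [dPre, map_add]; exact mk_eq (Rel.right_add _ _ _)
  | right_smul c r g => simp only [dPre, map_smul]; exact mk_eq (Rel.right_smul _ _ _)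
  | right_id c e =>
    simp only [dPre]
    have : D.d h (D.id e) = 0 := D.d_id_cast rfl h
    rw [this]
    exact map_zero (inr c).map
  | right_comp c h' g g' =>
    simp only [dPre, ← inr_map]
    rw [D.leibniz h' rfl rfl h, map_add, map_smul, GrFunctor.map_comp, GrFunctor.map_comp]
    rfl
  | eps_id c e h' => simp only [dPre, epsD_id]; rfl
  | eps_add f f' g h' => simp only [dPre, epsD_add]; rfl
  | eps_smul r f g h' => simp only [dPre, epsD_smul]; rfl
  | eps_lin f r hg h' =>
    simp only [dPre]
    exact epsD_isMultiLin f _ _ _ _ _ _ _ _ _ hg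
  | eps_hasId f hg h' =>
    simp only [dPre, epsD, RawCoch.sub_apply]
    rw [epsC_isNormal _ _ _ _ _ _ _ hg,
      (epsC_isNormal f).hoch (epsC_isMultiLin f) _ _ _ _ _ _ hg, sub_zero]
    rfl
  | eps_id_pos c hg h' => simp only [dPre, epsD_id]; rfl
  | @eps_comp c c' c'' e e' a₁ a₂ a t m ha f₂ f₁ g h' =>
    have e₁ := splitSum_map (dPre h) (fun _ _ => rfl) g fun e'' s r hsr g₁ g₂ =>
      smul (sgn k (a₁ * r)) (comp (m := a₂ + r) (n := a₁ + s) (p := m) (by omega)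
        (eps f₂ g₂ rfl) (eps f₁ g₁ rfl))
    refine Eq.trans ?_ e₁.symm
    simp only [dPre]
    rw [epsD_comp, RawCoch.add_apply, RawCoch.smul_apply, RawCoch.mul_apply, RawCoch.mul_apply,
      ← splitSum_smul, ← splitSum_add]
    congr 1
    funext y s r hsr g₁ g₂
    rw [_root_.smul_add, smul_smul, smul_smul]
    congr 1
    · congr 1
      exact RawCoch.comp_congr (epsD f₂) (epsC f₁) _ _ _ _ _ _ _ _
    · congr 1
      · rw [_root_.add_mul, sgn_add, sgn_add, _root_.one_mul]
        rcases sgn_cases (k := k) r with h1 | h1 <;> rw [h1] <;> ring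
      · exact RawCoch.comp_congr (epsC f₂) (epsD f₁) _ _ _ _ _ _ _ _

end Pre

namespace Pre

variable {C D : DGCat k}

/-- The differential of the twisted tensor product. -/
def dHom {X Y : C.Obj × D.Obj} {m n : ℤ} (h : m + 1 = n) :
    Hom C.toGrCat D.toGrCat X Y m →ₗ[k] Hom C.toGrCat D.toGrCat X Y n where
  toFun := Quot.lift (dPre h) fun _ _ hxy => dPre_rel h hxy
  map_add' x y := by
    induction x using Quot.ind; induction y using Quot.ind
    rfl
  map_smul' r x := by
    induction x using Quot.ind
    rfl

theorem dHom_mk {X Y : C.Obj × D.Obj} {m n : ℤ} (h : m + 1 = n)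
    (x : Pre C.toGrCat D.toGrCat X Y m) : dHom h (mk x) = dPre h x := rfl

/-- The differential of the twisted tensor product, as a derivation. -/
def der (C D : DGCat k) : GrDer (C.toGrCat.twistedTensor D.toGrCat) where
  d h := dHom h
  leibniz h hm hn hp x y := by
    subst hm hn hp
    induction x using Quot.ind; induction y using Quot.ind
    rfl

theorem inr_map_d (c : C.Obj) {e e' : D.Obj} {m n : ℤ} (h : m + 1 = n) (g : D.Hom e e' m) :
    (inr (C := C.toGrCat) c).map (D.d h g) = (der C D).d h ((inr (C := C.toGrCat) c).map g) := rfl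

theorem post_epsC {c c' : C.Obj} {a : ℤ} (f : C.Hom c c' a) :
    RawCoch.post (der C D) rfl (epsC f) = epsD f := by
  funext e e' t q h g
  rfl

theorem post_epsD {c c' : C.Obj} {a : ℤ} (f : C.Hom c c' a) :
    RawCoch.post (der C D) (p' := a + 1 + 1) rfl (epsD f) = 0 := by
  have hF := RawCoch.maurerCartan (der C D) (inr c) (inr_map_d c)
  have hG := RawCoch.maurerCartan (der C D) (inr c') (inr_map_d c')
  have e₂ := RawCoch.hoch_hoch (p'' := a + 1 + 1) rfl rfl (epsC f)
    (epsC_isMultiLin (D := D.toGrCat) f)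
  have e₃ := RawCoch.post_hoch (p'' := a + 1 + 1) (der C D) rfl rfl (epsC f)
  have e₄ := RawCoch.add_mul (p₁ := a) (p := a + 1 + 1) (by omega)
    (RawCoch.bar (p' := 2) rfl (RawCoch.tau (inr (C := C.toGrCat) (D := D.toGrCat) c')) +
      RawCoch.mul (p := 2) rfl (RawCoch.tau (inr c')) (RawCoch.tau (inr c')))
    (RawCoch.post (der C D) (p' := 2) rfl (RawCoch.tau (inr c'))) (epsC f)
  have e₅ := RawCoch.mul_add (p₂ := a) (p := a + 1 + 1) (by omega) (epsC f)
    (RawCoch.bar (p' := 2) rfl (RawCoch.tau (inr (C := C.toGrCat) (D := D.toGrCat) c)) +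
      RawCoch.mul (p := 2) rfl (RawCoch.tau (inr c)) (RawCoch.tau (inr c)))
    (RawCoch.post (der C D) (p' := 2) rfl (RawCoch.tau (inr c)))
  rw [hG, RawCoch.zero_mul] at e₄
  rw [hF, RawCoch.mul_zero] at e₅
  rw [post_epsC] at e₃
  have e₆ : RawCoch.hoch (p' := a + 1 + 1) (inr c) (inr c') rfl (epsD (D := D) f) =
      RawCoch.hoch (inr c) (inr c') rfl (epsC (C.d rfl f)) +
        -RawCoch.hoch (inr c) (inr c') rfl (RawCoch.hoch (inr c) (inr c') rfl (epsC f)) := by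
    rw [epsD, sub_eq_add_neg, ← neg_one_smul k, RawCoch.hoch_add, RawCoch.hoch_smul, neg_one_smul]
  have e₇ : epsD (D := D) (C.d rfl f) =
      -RawCoch.hoch (p' := a + 1 + 1) (inr c) (inr c') rfl (epsC (C.d rfl f)) := by
    rw [epsD, C.d_d, epsC_zero, zero_sub]
  rw [epsD, sub_eq_add_neg, ← neg_one_smul k, RawCoch.post_add, RawCoch.post_smul, post_epsC, e₃, e₆,
    e₂, e₇, eq_neg_of_add_eq_zero_left e₄.symm, eq_neg_of_add_eq_zero_left e₅.symm]
  module

theorem dHom_dPre {X Y : C.Obj × D.Obj} {l m n : ℤ} (h : l + 1 = m) (h' : m + 1 = n)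
    (x : Pre C.toGrCat D.toGrCat X Y l) : dHom h' (dPre h x) = 0 := by
  subst h h'
  induction x with
  | zero => simp only [dPre, map_zero]
  | add x y hx hy => simp only [dPre, map_add, hx, hy, add_zero]
  | smul r x hx => simp only [dPre, map_smul, hx, smul_zero]
  | id X => simp only [dPre, map_zero]
  | right c g =>
    simp only [dPre, dHom_mk, D.d_d]
    exact map_zero (inr c).map
  | eps f g h =>
    subst h
    simp only [dPre]
    rename_i a t
    have e : RawCoch.post (der C D) (p' := a + 1 + 1) rfl (epsD f) _ _ _ (a + t + 1 + 1) (by omega) g =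
        0 := by
      rw [post_epsD]; rfl
    exact (RawCoch.d_congr (der C D) (epsD f) _ _ _ _ g).trans e
  | @comp X Y Z m n p h x y hx hy =>
    subst h
    simp only [dPre, map_add, map_smul]
    have e₁ := (der C D).leibniz (p' := m + n + 1 + 1) (by omega) rfl rfl rfl (dPre rfl x) (mk y)
    have e₂ := (der C D).leibniz (p' := m + n + 1 + 1) (by omega) rfl rfl rfl (mk x) (dPre rfl y)
    change dHom _ _ = (C.toGrCat.twistedTensor D.toGrCat).comp _ (dHom _ _) _ + _ at e₁
    change dHom _ _ = _ + _ • (C.toGrCat.twistedTensor D.toGrCat).comp _ _ (dHom _ _) at e₂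
    rw [hx, map_zero, LinearMap.zero_apply, zero_add] at e₁
    rw [hy, map_zero, smul_zero, add_zero] at e₂
    refine (congrArg₂ (fun u v => u + sgn k m • v) e₁ e₂).trans ?_
    rw [sgn_add, sgn_one, mul_neg_one, neg_smul]
    exact neg_add_cancel _

end Pre

/-- The twisted tensor product of small dg categories: the graded category
`C.toGrCat.twistedTensor D.toGrCat` with the differential given on generators by
`d (id_c ⊗ g) = id_c ⊗ d g`, `d (f ⊗ id_e) = d f ⊗ id_e` and, for `n ≥ 1`,
`d ε(f; g₁, …, gₙ) = ε(d f; g₁, …, gₙ)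
  + (-1) ^ |f| (-∑_j (-1) ^ (∑_{i > j} (|g_i| - 1)) ε(f; g₁, …, d g_j, …, gₙ)
    + ∑_{j < n} (-1) ^ (|g_{j+1}| + ∑_{i > j + 1} (|g_i| - 1)) ε(f; g₁, …, g_{j+1} ∘ g_j, …, gₙ))
  - (-1) ^ (|f| (|gₙ| - 1)) (id ⊗ gₙ) ∘ ε(f; g₁, …, g_{n-1})
  + (-1) ^ (|f| + ∑_{i ≥ 2} (|g_i| - 1)) ε(f; g₂, …, gₙ) ∘ (id ⊗ g₁)`. -/
def DGCat.twistedTensor (C D : DGCat k) : DGCat k where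
  toGrCat := C.toGrCat.twistedTensor D.toGrCat
  d h := Pre.dHom h
  d_d h₁ h₂ x := by
    induction x using Quot.ind
    exact Pre.dHom_dPre h₁ h₂ _
  leibniz := (Pre.der C D).leibniz

/-! ### Functoriality of the twisted tensor product -/

/-- The identity functor of a graded category. -/
def GrFunctor.id (C : GrCat k) : GrFunctor C C where
  obj X := X
  map := LinearMap.id
  map_id _ := rfl
  map_comp _ _ _ := rfl

/-- The identity functor of a dg category. -/
def DGFunctor.id (C : DGCat k) : DGFunctor C C where
  toGrFunctor := GrFunctor.id C.toGrCat
  map_d _ _ := rfl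

theorem Chain.map_id {D : GrCat k} {y₀ y : D.Obj} {t : ℤ} (c : Chain D y₀ y t) :
    c.map (GrFunctor.id D) = c := by
  induction c with
  | nil => simp only [Chain.map]; rfl
  | snoc c g h ih => simp only [Chain.map]; rw [ih]; rfl

namespace Pre

section

variable {C C' D D' : GrCat k}

/-- The action of a pair of functors on formal expressions:
`ε(f; g₁, …, gₙ) ↦ ε(a f; b g₁, …, b gₙ)` and `id_c ⊗ g ↦ id_{a c} ⊗ b g`. -/
def map (a : GrFunctor C C') (b : GrFunctor D D') : ∀ {X Y : C.Obj × D.Obj} {m : ℤ},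
    Pre C D X Y m → Pre C' D' (a.obj X.1, b.obj X.2) (a.obj Y.1, b.obj Y.2) m
  | _, _, _, zero => zero
  | _, _, _, add x y => add (x.map a b) (y.map a b)
  | _, _, _, smul r x => smul r (x.map a b)
  | _, _, _, id _ => id _
  | _, _, _, comp h x y => comp h (x.map a b) (y.map a b)
  | _, _, _, eps f g h => eps (a.map f) (g.map b) h
  | _, _, _, right c g => right (a.obj c) (b.map g)

theorem Rel.map (a : GrFunctor C C') (b : GrFunctor D D') {X Y : C.Obj × D.Obj} {m : ℤ}
    {x y : Pre C D X Y m} (h : Rel x y) : Rel (x.map a b) (y.map a b) := by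
  induction h with
  | add_congr_left y _ ih => exact add_congr_left _ ih
  | add_congr_right x _ ih => exact add_congr_right _ ih
  | smul_congr r _ ih => exact smul_congr _ ih
  | comp_congr_left h y hx ih => exact comp_congr_left _ _ ih
  | comp_congr_right h y hx ih => exact comp_congr_right _ _ ih
  | add_comm x y => exact add_comm _ _
  | add_assoc x y z => exact add_assoc _ _ _
  | zero_add x => exact zero_add _
  | one_smul x => exact one_smul _
  | mul_smul r s x => exact mul_smul _ _ _
  | smul_add r x y => exact smul_add _ _ _
  | add_smul r s x => exact add_smul _ _ _
  | zero_smul x => exact zero_smul _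
  | comp_add h x y y' => exact comp_add _ _ _ _
  | comp_smul h x r y => exact comp_smul _ _ _ _
  | add_comp h x x' y => exact add_comp _ _ _ _
  | smul_comp h r x y => exact smul_comp _ _ _ _
  | id_comp h x => exact id_comp _ _
  | comp_id h x => exact comp_id _ _
  | assoc h₁ h₂ h₃ h₄ x y z => exact assoc h₁ h₂ h₃ h₄ _ _ _
  | right_add c g g' => simp only [Pre.map, map_add]; exact right_add _ _ _
  | right_smul c r g => simp only [Pre.map, map_smul]; exact right_smul _ _ _
  | right_id c e => simp only [Pre.map, b.map_id]; exact right_id _ _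
  | right_comp c h g g' => simp only [Pre.map, b.map_comp]; exact right_comp _ _ _ _
  | eps_id c e h => simp only [Pre.map, a.map_id, Chain.map]; exact eps_id _ _ _
  | eps_add f f' g h => simp only [Pre.map, map_add]; exact eps_add _ _ _ _
  | eps_smul r f g h => simp only [Pre.map, map_smul]; exact eps_smul _ _ _ _
  | eps_lin f r hg h => exact eps_lin _ r (hg.map b) _
  | eps_hasId f hg h => exact eps_hasId _ (hg.map b) _
  | eps_id_pos c hg h => simp only [Pre.map, a.map_id]; exact eps_id_pos _ (hg.map b) _
  | @eps_comp c c' c'' e e' a₁ a₂ a' t m ha f₂ f₁ g h =>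
    have e₁ := splitSum_map (Pre.map a b) (fun _ _ => rfl) g fun e'' s r hsr g₁ g₂ =>
      smul (sgn k (a₁ * r)) (comp (m := a₂ + r) (n := a₁ + s) (p := m) (by omega)
        (eps f₂ g₂ rfl) (eps f₁ g₁ rfl))
    have e₂ := eps_comp ha (a.map f₂) (a.map f₁) (g.map b) h
    rw [splitSum_chainMap, ← a.map_comp] at e₂
    rw [e₁]
    exact e₂

/-- The graded functor between twisted tensor products given by a pair of functors. -/
def mapFunctor (a : GrFunctor C C') (b : GrFunctor D D') :
    GrFunctor (C.twistedTensor D) (C'.twistedTensor D') where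
  obj X := (a.obj X.1, b.obj X.2)
  map :=
    { toFun := Quot.map (Pre.map a b) fun _ _ h => h.map a b
      map_add' := fun x y => by
        induction x using Quot.ind; induction y using Quot.ind
        rfl
      map_smul' := fun r x => by
        induction x using Quot.ind
        rfl }
  map_id _ := rfl
  map_comp h x y := by
    induction x using Quot.ind; induction y using Quot.ind
    rfl

theorem mapFunctor_mk (a : GrFunctor C C') (b : GrFunctor D D') {X Y : C.Obj × D.Obj} {m : ℤ}
    (x : Pre C D X Y m) : (mapFunctor a b).map (mk x) = mk (x.map a b) := rfl

theorem map_epsC (a : GrFunctor C C') (b : GrFunctor D D') {c c' : C.Obj} {m : ℤ}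
    (f : C.Hom c c' m) :
    RawCoch.map (GrFunctor.id D) (mapFunctor a b) (epsC f) =
      RawCoch.map b (GrFunctor.id _) (epsC (a.map f)) := by
  funext e e' t q h g
  have : RawCoch.map (GrFunctor.id D) (mapFunctor a b) (epsC f) e e' t q h g =
    mk (eps (a.map f) ((g.map (GrFunctor.id D)).map b) h) := rfl
  rw [this, Chain.map_id]
  rfl

end

variable {C C' D D' : DGCat k}

theorem map_epsD (a : DGFunctor C C') (b : DGFunctor D D') {c c' : C.Obj} {m : ℤ}
    (f : C.Hom c c' m) :
    RawCoch.map (GrFunctor.id D.toGrCat) (mapFunctor a.toGrFunctor b.toGrFunctor) (epsD f) =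
      RawCoch.map b.toGrFunctor (GrFunctor.id _) (epsD (a.map f)) := by
  have e₁ := RawCoch.map_hoch (F := inr c) (G := inr c') (p' := m + 1) (DGFunctor.id D)
    (mapFunctor a.toGrFunctor b.toGrFunctor) rfl (epsC f)
  have e₂ := RawCoch.map_hoch (F := inr (a.obj c)) (G := inr (a.obj c')) (p' := m + 1) b
    (GrFunctor.id _) rfl (epsC (D := D'.toGrCat) (a.map f))
  unfold epsD
  rw [RawCoch.map_sub', RawCoch.map_sub', map_epsC, a.map_d]
  congr 1
  refine e₁.trans (Eq.trans ?_ e₂.symm)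
  exact congrArg (RawCoch.hoch _ _ rfl) (map_epsC a.toGrFunctor b.toGrFunctor f)

theorem map_dPre (a : DGFunctor C C') (b : DGFunctor D D') {X Y : C.Obj × D.Obj} {m n : ℤ}
    (h : m + 1 = n) (x : Pre C.toGrCat D.toGrCat X Y m) :
    (mapFunctor a.toGrFunctor b.toGrFunctor).map (dPre h x) =
      dPre h (x.map a.toGrFunctor b.toGrFunctor) := by
  induction x generalizing n with
  | zero => exact map_zero _
  | add x y hx hy => exact (map_add _ _ _).trans (congrArg₂ (· + ·) (hx h) (hy h))
  | smul r x hx => exact (map_smul _ _ _).trans (congrArg (r • ·) (hx h))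
  | id X => exact map_zero _
  | comp h' x y hx hy =>
    simp only [dPre, Pre.map]
    rw [← hx, ← hy]
    refine (map_add _ _ _).trans ?_
    rw [map_smul, GrFunctor.map_comp, GrFunctor.map_comp]
    rfl
  | eps f g h' =>
    simp only [dPre, Pre.map]
    have e := congrArg (fun Ψ => Ψ _ _ _ n (by omega) g) (map_epsD a b f)
    simp only [RawCoch.map] at e
    rw [Chain.map_id] at e
    exact e
  | right c g =>
    simp only [dPre, Pre.map]
    rw [← b.map_d]
    rfl

end Pre

/-- Functoriality of the twisted tensor product in both arguments. -/
def DGCat.twistedTensor.map {C C' D D' : DGCat k} (a : DGFunctor C C') (b : DGFunctor D D') :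
    DGFunctor (C.twistedTensor D) (C'.twistedTensor D') where
  toGrFunctor := Pre.mapFunctor a.toGrFunctor b.toGrFunctor
  map_d h x := by
    induction x using Quot.ind
    exact Pre.map_dPre a b h _

end DG

/-!
The morphisms `id_c ⊗ g` make `e ↦ (c, e)` a dg functor `D ⥤ C ⊗̃ D` for each object `c` of `C`, and
for fixed `f : c ⟶ c'` the generators `ε(f; g₁, …, gₙ)` assemble into a normalised cochain
`ε f` between the functors of `c` and `c'`. The defining relations of the twisted tensor product say
exactly that `f ↦ ε f` is a graded functor to `Coh D (C ⊗̃ D)`, and the formula for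
`d ε(f; g₁, …, gₙ)` says that it commutes with the differentials: `d ∘ ε f = ε (d f) - hoch (ε f)` is
the same equation as `ε (d f) = d ∘ ε f + hoch (ε f)`, whose right-hand side is the differential in
`Coh`.
This is the unit dg functor `C ⥤ Coh D (C ⊗̃ D)`, and currying sends `F : C ⊗̃ D ⥤ E` to
`c ↦ F (c, -)`, `f ↦ F ∘ ε f`.

Conversely, a dg functor `G : C ⥤ Coh D E` prescribes values on the generators,
`id_c ⊗ g ↦ (G c) g` and `ε(f; g₁, …, gₙ) ↦ (G f)(g₁, …, gₙ)`. These values are extended to formal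
expressions by `Pre.eval`. The extension respects the relations (`Pre.eval_rel`) because `G` is a
functor with values in normalised cochains, and it commutes with the differential (`Pre.eval_d`)
because `G` does. The two constructions are mutually inverse since a functor on `C ⊗̃ D` is determined
by its values on generators (`Pre.eval_curry`). Naturality can be read off generators as well, where
both sides send `f` to the cochain `(g₁, …, gₙ) ↦ h (F (ε(a f; b g₁, …, b gₙ)))`.
-/

namespace DG

open Chain

variable {k : Type u} [CommRing k]

/-! ### Equality of dg functors -/

theorem DGFunctor.ext_heq {C D : DGCat k} {F G : DGFunctor C D} (hobj : F.obj = G.obj)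
    (hmap : ∀ (X Y : C.Obj) (n : ℤ) (f : C.Hom X Y n), HEq (F.map f) (G.map f)) : F = G := by
  obtain ⟨⟨obj, map, _, _⟩, _⟩ := F
  obtain ⟨⟨obj', map', _, _⟩, _⟩ := G
  change obj = obj' at hobj
  subst hobj
  obtain rfl : @map = @map' := by
    funext X Y n
    exact LinearMap.ext fun f => eq_of_heq (hmap X Y n f)
  rfl

/-! ### Postcomposition of cochains with a functor -/

namespace RawCoch

/-- The cochain `h ∘ Ψ`. In contrast to `RawCoch.map (GrFunctor.id D) h Ψ`, its value on a chain is
definitionally the image under `h` of the value of `Ψ` on the same chain. -/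
def postcomp {D E E' : GrCat k} {F G : D.Obj → E.Obj} {p : ℤ} (h : GrFunctor E E')
    (Ψ : RawCoch D E F G p) :
    RawCoch D E' (fun y => h.obj (F y)) (fun y => h.obj (G y)) p :=
  fun _ _ _ _ hq c => h.map (Ψ _ _ _ _ hq c)

theorem postcomp_eq_map {D E E' : GrCat k} {F G : D.Obj → E.Obj} {p : ℤ} (h : GrFunctor E E')
    (Ψ : RawCoch D E F G p) : postcomp h Ψ = map (GrFunctor.id D) h Ψ := by
  funext y₀ y₁ t q hq c
  have e : map (GrFunctor.id D) h Ψ y₀ y₁ t q hq c =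
    h.map (Ψ y₀ y₁ t q hq (c.map (GrFunctor.id D))) := rfl
  rw [e, Chain.map_id]
  rfl

end RawCoch

/-- Postcomposition with a dg functor, on coherent natural transformations. -/
def cohPostcomp {D E E' : DGCat k} (h : DGFunctor E E') {F G : DGFunctor D E} {p : ℤ} :
    CohHom F G p →ₗ[k] CohHom (F.comp h) (G.comp h) p where
  toFun Ψ := ⟨RawCoch.postcomp h.toGrFunctor Ψ.1,
    by rw [RawCoch.postcomp_eq_map]; exact Ψ.2.1.map,
    by rw [RawCoch.postcomp_eq_map]; exact Ψ.2.2.map⟩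
  map_add' Ψ Ψ' := Subtype.ext (by
    funext y₀ y₁ t q hq c
    exact map_add _ _ _)
  map_smul' x Ψ := Subtype.ext (by
    funext y₀ y₁ t q hq c
    exact map_smul _ _ _)

/-- The dg functor `Coh D E ⥤ Coh D E'`, `F ↦ h ∘ F`, `Ψ ↦ h ∘ Ψ`. -/
def DGCat.Coh.postcomp (D : DGCat k) {E E' : DGCat k} (h : DGFunctor E E') :
    DGFunctor (D.Coh E) (D.Coh E') where
  obj (F : DGFunctor D E) := F.comp h
  map := cohPostcomp h
  map_id F := Subtype.ext
    ((RawCoch.postcomp_eq_map _ _).trans (RawCoch.map_one (F := F.obj) _ _))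
  map_comp e Ψ₂ Ψ₁ := Subtype.ext (by
    change RawCoch.postcomp h.toGrFunctor (RawCoch.mul e Ψ₂.1 Ψ₁.1) =
      RawCoch.mul e (RawCoch.postcomp h.toGrFunctor Ψ₂.1) (RawCoch.postcomp h.toGrFunctor Ψ₁.1)
    simp only [RawCoch.postcomp_eq_map]
    exact RawCoch.map_mul _ _ e Ψ₂.1 Ψ₁.1)
  map_d {F G m n} e Ψ := Subtype.ext (by
    have key := congrArg Subtype.val
      ((DGCat.Coh.map (DGFunctor.id D) h).map_d (X := F) (Y := G) e Ψ)
    change RawCoch.map (GrFunctor.id _) h.toGrFunctor (cohD F G e Ψ.1) =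
      cohD (F.comp h) (G.comp h) e (RawCoch.map (GrFunctor.id _) h.toGrFunctor Ψ.1) at key
    change RawCoch.postcomp h.toGrFunctor (cohD F G e Ψ.1) =
      cohD (F.comp h) (G.comp h) e (RawCoch.postcomp h.toGrFunctor Ψ.1)
    rw [RawCoch.postcomp_eq_map, RawCoch.postcomp_eq_map]
    exact key)

/-! ### The unit -/

/-- The dg functor `e ↦ (c, e)`, `g ↦ id_c ⊗ g`. -/
def DGCat.twistedTensor.inr {C : DGCat k} (D : DGCat k) (c : C.Obj) :
    DGFunctor D (C.twistedTensor D) where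
  toGrFunctor := Pre.inr c
  map_d h g := Pre.inr_map_d c h g

/-- The map `f ↦ ((g₁, …, gₙ) ↦ ε(f; g₁, …, gₙ))`. -/
def cohEps {C : DGCat k} (D : DGCat k) {c c' : C.Obj} {p : ℤ} :
    C.Hom c c' p →ₗ[k]
      CohHom (DGCat.twistedTensor.inr D c) (DGCat.twistedTensor.inr D c') p where
  toFun f := ⟨Pre.epsC f, Pre.epsC_isMultiLin f, Pre.epsC_isNormal f⟩
  map_add' f f' := Subtype.ext (Pre.epsC_add f f')
  map_smul' r f := Subtype.ext (Pre.epsC_smul r f)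

/-- The dg functor `C ⥤ Coh D (C ⊗̃ D)`, `f ↦ ((g₁, …, gₙ) ↦ ε(f; g₁, …, gₙ))`. -/
def DGCat.twistedTensor.unit (C D : DGCat k) : DGFunctor C (D.Coh (C.twistedTensor D)) where
  obj c := DGCat.twistedTensor.inr D c
  map := cohEps D
  map_id c := Subtype.ext (Pre.epsC_id c)
  map_comp h f₂ f₁ := Subtype.ext (Pre.epsC_comp h f₂ f₁)
  map_d h f := Subtype.ext (by
    subst h
    change Pre.epsC (C.d rfl f) = RawCoch.post (Pre.der C D) rfl (Pre.epsC f) +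
      RawCoch.hoch (Pre.inr _) (Pre.inr _) rfl (Pre.epsC f)
    rw [Pre.post_epsC, Pre.epsD]
    exact (sub_add_cancel (Pre.epsC (C.d rfl f)) _).symm)

/-! ### Currying -/

/-- The dg functor `c ↦ F (c, -)`, `f ↦ ((g₁, …, gₙ) ↦ F (ε(f; g₁, …, gₙ)))`. -/
def DGFunctor.curry {C D E : DGCat k} (F : DGFunctor (C.twistedTensor D) E) :
    DGFunctor C (D.Coh E) :=
  (DGCat.twistedTensor.unit C D).comp (DGCat.Coh.postcomp D F)

/-! ### Uncurrying -/

namespace Pre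

variable {C D E : DGCat k}

/-- The object `G c` of `Coh D E`, as a dg functor. -/
abbrev fiber (G : DGFunctor C (D.Coh E)) (c : C.Obj) : DGFunctor D E := G.obj c

/-- The morphism `G f` of `Coh D E`, as a cochain. -/
abbrev cochain (G : DGFunctor C (D.Coh E)) {c c' : C.Obj} {a : ℤ} (f : C.Hom c c' a) :
    CohHom (fiber G c) (fiber G c') a := G.map f

/-- The value on a formal expression of the functor `C ⊗̃ D ⥤ E` that corresponds to
`G : C ⥤ Coh D E`. -/
def eval (G : DGFunctor C (D.Coh E)) : ∀ {X Y : C.Obj × D.Obj} {m : ℤ},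
    Pre C.toGrCat D.toGrCat X Y m →
      E.Hom ((fiber G X.1).obj X.2) ((fiber G Y.1).obj Y.2) m
  | _, _, _, zero => 0
  | _, _, _, add x y => x.eval G + y.eval G
  | _, _, _, smul r x => r • x.eval G
  | _, _, _, id _ => E.id _
  | _, _, _, comp h x y => E.comp h (x.eval G) (y.eval G)
  | _, _, _, eps f g h => (cochain G f).1 _ _ _ _ h g
  | _, _, _, right c g => (fiber G c).map g

theorem eval_rel (G : DGFunctor C (D.Coh E)) {X Y : C.Obj × D.Obj} {m : ℤ}
    {x y : Pre C.toGrCat D.toGrCat X Y m} (h : Rel x y) : x.eval G = y.eval G := by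
  induction h with
  | add_congr_left y _ ih => simp only [eval, ih]
  | add_congr_right x _ ih => simp only [eval, ih]
  | smul_congr r _ ih => simp only [eval, ih]
  | comp_congr_left h y hx ih => simp only [eval, ih]
  | comp_congr_right h y hx ih => simp only [eval, ih]
  | add_comm x y => exact _root_.add_comm _ _
  | add_assoc x y z => exact _root_.add_assoc _ _ _
  | zero_add x => exact _root_.zero_add _
  | one_smul x => exact _root_.one_smul _ _
  | mul_smul r s x => exact SemigroupAction.mul_smul _ _ _
  | smul_add r x y => exact _root_.smul_add _ _ _
  | add_smul r s x => exact _root_.add_smul _ _ _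
  | zero_smul x => exact _root_.zero_smul _ _
  | comp_add h x y y' => exact map_add _ _ _
  | comp_smul h x r y => exact map_smul _ _ _
  | add_comp h x x' y => simp only [eval, map_add, LinearMap.add_apply]
  | smul_comp h r x y => simp only [eval, map_smul, LinearMap.smul_apply]
  | id_comp h x => exact E.id_comp _
  | comp_id h x => exact E.comp_id _
  | assoc h₁ h₂ h₃ h₄ x y z => exact E.assoc h₁ h₂ h₃ h₄ _ _ _
  | right_add c g g' => exact map_add (fiber G c).map _ _
  | right_smul c r g => exact map_smul (fiber G c).map _ _
  | right_id c e => exact (fiber G c).map_id _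
  | right_comp c h g g' => exact (fiber G c).map_comp _ _ _
  | eps_id c e h => simp only [eval, G.map_id]; rfl
  | eps_add f f' g h => simp only [eval, map_add]; rfl
  | eps_smul r f g h => simp only [eval, map_smul]; rfl
  | eps_lin f r hg h => exact (cochain G f).2.1 _ _ _ _ _ r _ _ _ hg
  | eps_hasId f hg h => exact (cochain G f).2.2 _ _ _ _ _ _ hg
  | eps_id_pos c hg h =>
    simp only [eval, G.map_id]
    exact RawCoch.one_pos _ hg
  | @eps_comp c c' c'' e e' a₁ a₂ a t m ha f₂ f₁ g h =>
    have e₁ := splitSum_map (eval G) (fun _ _ => rfl) g fun e'' s r hsr g₁ g₂ =>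
      smul (sgn k (a₁ * r)) (comp (m := a₂ + r) (n := a₁ + s) (p := m) (by omega)
        (eps f₂ g₂ rfl) (eps f₁ g₁ rfl))
    refine Eq.trans ?_ e₁.symm
    simp only [eval, G.map_comp]
    rfl

/-- The graded functor `C ⊗̃ D ⥤ E` that corresponds to `G : C ⥤ Coh D E`. -/
def evalFunctor (G : DGFunctor C (D.Coh E)) :
    GrFunctor (C.toGrCat.twistedTensor D.toGrCat) E.toGrCat where
  obj X := (fiber G X.1).obj X.2
  map :=
    { toFun := Quot.lift (eval G) fun _ _ h => eval_rel G h
      map_add' := fun x y => by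
        induction x using Quot.ind; induction y using Quot.ind
        rfl
      map_smul' := fun r x => by
        induction x using Quot.ind
        rfl }
  map_id _ := rfl
  map_comp h x y := by
    induction x using Quot.ind; induction y using Quot.ind
    rfl

/-- The image of `d ε(f; …)` is the differential in `E` of `(G f)(…)`. -/
theorem postcomp_evalFunctor_epsD (G : DGFunctor C (D.Coh E)) {c c' : C.Obj} {a : ℤ}
    (f : C.Hom c c' a) :
    RawCoch.postcomp (evalFunctor G) (epsD f) = RawCoch.post E.der rfl (cochain G f).1 := by
  have e₁ := RawCoch.map_hoch (F := inr c) (G := inr c') (p' := a + 1) (DGFunctor.id D)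
    (evalFunctor G) rfl (epsC f)
  have e₂ : (cochain G (C.d rfl f)).1 = RawCoch.post E.der rfl (cochain G f).1 +
      RawCoch.hoch (fiber G c).toGrFunctor (fiber G c').toGrFunctor rfl
        (cochain G f).1 := congrArg Subtype.val (G.map_d rfl f)
  have e₃ : RawCoch.map (DGFunctor.id D).toGrFunctor (evalFunctor G) (epsC f) = (cochain G f).1 :=
    (RawCoch.postcomp_eq_map _ _).symm
  have e₄ : RawCoch.map (GrFunctor.id D.toGrCat) (evalFunctor G) (epsC (C.d rfl f)) =
      (cochain G (C.d rfl f)).1 := (RawCoch.postcomp_eq_map _ _).symm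
  rw [e₃] at e₁
  rw [RawCoch.postcomp_eq_map, epsD, RawCoch.map_sub', e₄, e₂]
  refine (congrArg _ e₁).trans ?_
  exact add_sub_cancel_right _ _

theorem eval_d (G : DGFunctor C (D.Coh E)) {X Y : C.Obj × D.Obj} {m n : ℤ} (h : m + 1 = n)
    (x : Pre C.toGrCat D.toGrCat X Y m) :
    (evalFunctor G).map (dPre h x) = E.d h (x.eval G) := by
  induction x generalizing n with
  | zero => exact (map_zero _).trans (map_zero _).symm
  | add x y hx hy =>
    exact (map_add _ _ _).trans ((congrArg₂ (· + ·) (hx h) (hy h)).trans (map_add _ _ _).symm)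
  | smul r x hx =>
    exact (map_smul _ _ _).trans ((congrArg (r • ·) (hx h)).trans (map_smul _ _ _).symm)
  | id X => exact (map_zero _).trans (E.d_id_cast rfl h).symm
  | comp h' x y hx hy =>
    simp only [dPre, eval]
    rw [E.leibniz h' rfl rfl h, ← hx, ← hy]
    refine (map_add _ _ _).trans ?_
    rw [map_smul, GrFunctor.map_comp, GrFunctor.map_comp]
    rfl
  | eps f g h' =>
    subst h'
    exact congrArg (fun Ψ => Ψ _ _ _ n (by omega) g) (postcomp_evalFunctor_epsD G f)
  | right c g => exact (fiber G c).map_d h g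

end Pre

/-- The dg functor `C ⊗̃ D ⥤ E` with `(c, e) ↦ (G c) e`, `id_c ⊗ g ↦ (G c) g` and
`ε(f; g₁, …, gₙ) ↦ (G f)(g₁, …, gₙ)`. -/
def DGFunctor.uncurry {C D E : DGCat k} (G : DGFunctor C (D.Coh E)) :
    DGFunctor (C.twistedTensor D) E where
  toGrFunctor := Pre.evalFunctor G
  map_d h x := by
    induction x using Quot.ind
    exact Pre.eval_d G h _

/-! ### The bijection -/

/-- A functor on `C ⊗̃ D` is recovered from its values on the generators. -/
theorem Pre.eval_curry {C D E : DGCat k} (F : DGFunctor (C.twistedTensor D) E)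
    {X Y : C.Obj × D.Obj} {m : ℤ} (x : Pre C.toGrCat D.toGrCat X Y m) :
    x.eval F.curry =
      GrFunctor.map (C := C.toGrCat.twistedTensor D.toGrCat) F.toGrFunctor (Pre.mk x) := by
  induction x with
  | zero => exact (map_zero _).symm
  | add x y hx hy => exact (congrArg₂ (· + ·) hx hy).trans (map_add _ _ _).symm
  | smul r x hx => exact (congrArg (r • ·) hx).trans (map_smul _ _ _).symm
  | id X => exact (F.map_id X).symm
  | comp h x y hx hy =>
    exact (congrArg₂ (fun u v => E.comp h u v) hx hy).trans (F.map_comp h _ _).symm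
  | eps f g h => rfl
  | right c g => rfl

/-- Currying, as a bijection. That uncurrying followed by currying is the identity holds
definitionally, since only the values on generators enter. -/
def DGFunctor.curryEquiv (C D E : DGCat k) :
    DGFunctor (C.twistedTensor D) E ≃ DGFunctor C (D.Coh E) where
  toFun := DGFunctor.curry
  invFun := DGFunctor.uncurry
  left_inv F := DGFunctor.ext_heq rfl fun X Y n x => heq_of_eq (by
    induction x using Quot.ind
    exact Pre.eval_curry F _)
  right_inv G := DGFunctor.ext_heq rfl fun X Y n f => HEq.rfl

end DG

theorem theorem0p1 (k : Type u) [Field k] :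
    ∃ Φ : ∀ C D E : DG.DGCat k, DG.DGFunctor (C.twistedTensor D) E ≃ DG.DGFunctor C (D.Coh E),
      ∀ (C C' D D' E E' : DG.DGCat k) (a : DG.DGFunctor C' C) (b : DG.DGFunctor D' D)
        (h : DG.DGFunctor E E') (F : DG.DGFunctor (C.twistedTensor D) E),
        Φ C' D' E' (((DG.DGCat.twistedTensor.map a b).comp F).comp h) =
          (a.comp (Φ C D E F)).comp (DG.DGCat.Coh.map b h) :=
  ⟨DG.DGFunctor.curryEquiv, fun _ _ _ _ _ _ _ _ _ _ =>
    DG.DGFunctor.ext_heq rfl fun _ _ _ _ => HEq.rfl⟩
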